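/- Write $[n]=\{1,\dots,n\}$ and, for $M\subseteq[n]$, let $\binom{[n]}{M}$ be the family of all subsets of $[n]$ whose size lies in $M$; $\binom{[n]}{k}$ denotes the family of all $k$-subsets of $[n]$, and $R\bigtriangleup S$ is the symmetric difference. Families $\mathcal A,\mathcal B$ of subsets of $[n]$ are cross $t$-intersecting if $|A\cap B|\ge t$ for all $A\in\mathcal A$ and $B\in\mathcal B$. **Theorem.** Let $n,r,s,t$ be positive integers and let $R,S$ be non-empty subsets of $[n]$ with $t\le\min(R\cup S)$, $r=\max R$, $s=\max S$ and $r+s-t<n$. If $\mathcal A\subseteq\binom{[n]}{R}$ and $\mathcal B\subseteq\binom{[n]}{S}$ are non-empty and cross $t$-intersecting, then $$|\mathcal A|+|\mathcal B|\le\max\left\{1+\sum_{i\in S}\sum_{j=t}^{i}\binom rj\binom{n-r}{i-j},\ 1+\sum_{i\in R}\sum_{j=t}^{i}\binom sj\binom{n-s}{i-j}\right\}.\tag{1.1}$$ Moreover, the following hold. 1. If $R=S$ and $2r<n$, then equality holds in (1.1) if and only if one of the following holds: - (i) $\mathcal A=\{A\}$ and $\mathcal B=\{B\in\binom{[n]}{S}:|B\cap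 A|\ge t\}$ for some $A\in\binom{[n]}{r}$; - (ii) $\mathcal B=\{B\}$ and $\mathcal A=\{A\in\binom{[n]}{R}:|A\cap B|\ge t\}$ for some $B\in\binom{[n]}{s}$; - (iii) $R=S=\{1,2\}$ and $\mathcal A=\mathcal B=\{C\in\binom{[n]}{\{1,2\}}:i\in C\}$ for some $i\in[n]$; - (iv) $R=S=\{2\}$ and $\mathcal A=\mathcal B=\{C\in\binom{[n]}{2}:i\in C\}$ for some $i\in[n]$. 2. If $R\ne S$ and $\max\{2^{s+1}|R|(s-t)+2r+1,\ 2^{r+1}|S|(r-t)+2s+1\}\le n$, then equality holds in (1.1) if and only if one of the following holds: - (i) $\max(R\bigtriangleup S)\in S$, and $\mathcal A=\{A\}$ and $\mathcal B=\{B\in\binom{[n]}{S}:|B\cap A|\ge t\}$ for some $A\in\binom{[n]}{r}$; - (ii) $\max(R\bigtriangleup S)\in R$, and $\mathcal B=\{B\}$ and $\mathcal A=\{A\in\binom{[n]}{R}:|A\cap B|\ge t\}$ for some $B\in\binom{[n]}{s}$. -/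

import Mathlib

/-- The family of all subsets of an `n`-element ground set whose size belongs to `M`. -/
def layers (n : ℕ) (M : Finset ℕ) : Finset (Finset (Fin n)) :=
  Finset.univ.filter fun A => A.card ∈ M

/-- The families `𝒜` and `ℬ` are cross `t`-intersecting: every member of `𝒜` meets every member
of `ℬ` in at least `t` elements. -/
def CrossIntersecting {n : ℕ} (t : ℕ) (𝒜 ℬ : Finset (Finset (Fin n))) : Prop :=
  ∀ A ∈ 𝒜, ∀ B ∈ ℬ, t ≤ (A ∩ B).card

/-- The number `1 + ∑_{i ∈ M} ∑_{j = t}^{i} C(a, j) C(n - a, i - j)`. -/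
def starBound (n t a : ℕ) (M : Finset ℕ) : ℕ :=
  1 + ∑ i ∈ M, ∑ j ∈ Finset.Icc t i, a.choose j * (n - a).choose (i - j)

/-- `𝒳` consists of a single set `X` of size `a`, and `𝒴` consists of all sets with size in `M`
that meet `X` in at least `t` elements. -/
def IsSingletonPair {n : ℕ} (t a : ℕ) (M : Finset ℕ) (𝒳 𝒴 : Finset (Finset (Fin n))) : Prop :=
  ∃ X : Finset (Fin n), X.card = a ∧ 𝒳 = {X} ∧ 𝒴 = (layers n M).filter fun Y => t ≤ (Y ∩ X).card

/-- `𝒜` and `ℬ` are both equal to the family of all sets with size in `M` that contain a fixed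
element. -/
def IsStarPair {n : ℕ} (M : Finset ℕ) (𝒜 ℬ : Finset (Finset (Fin n))) : Prop :=
  ∃ i : Fin n, 𝒜 = (layers n M).filter (fun C => i ∈ C) ∧ ℬ = (layers n M).filter (fun C => i ∈ C)

/-!
The bound is proved for weighted families on an initial segment of the ground set. Restricting the
sets to the first `a` of the `n` points, a trace `U` gets as weight the number
`extCount (n - a) R U.card` of ways to enlarge it by later points to a size in `R` (or in `S`, for
the other family). Both families may be assumed shifted, since shifting keeps the number of sets
of each size.

The heart of the matter is the passage from `a + 1` points to `a` points (`exists_projection`).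
The last point is indispensable only for pairs `U`, `V` that contain it and have exactly `t`
common elements. By shiftedness, `U ∪ V` is then the whole set of `a + 1` points, so
`|U| + |V| = a + 1 + t`. For each size `u`, one may discard the critical `u`-sets of one family,
or the matching critical sets of the other family; whichever are kept can be replaced by both
choices for the last point. As the binomial coefficients satisfy
`C(N, p) C(N, q) ≤ C(N, p + 1) C(N, q + 1)` whenever `p + q < N`, which is where `r + s - t < n`
enters, at least one of the two options does not lose weight (`extCount_mul_le`, `exchange_le`).
The process stops only when one family consists of the whole set of `a` points alone, and the
total is then at most the size `pairTotal n t R S a` of the pair formed by all sets containing a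
fixed `a`-set and all sets meeting it in at least `t` elements, or the same with the roles
exchanged.

As a function of `a ∈ [t, r]`, once `pairTotal` increases it keeps increasing
(`pairTotal_increase_persists`), again by log-concavity; so its maximum is at `a = r`, the
extremal value, or at `a = t`, where the two kinds of pairs agree and one of them does not
decrease.

If `r + s - t + 1 < n`, the inequality between the binomial products is strict. Shifted extremal
families are therefore canonical (`exists_isCanonicalPair`), and `pairTotal` attains the maximum
only at the end `r`, except for the stars of a point for equal sets of sizes `{2}` and `{1, 2}`.
For different sets of sizes and large `n`, the two ends and the value at `a = t` are compared
through the growth of `C(N, k)` in `k` (`mul_choose_lt_choose`). Finally the shifts are undone: a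
single set of size `r` comes from a single set of size `r`, and for stars this is an elementary
statement on graphs (`exists_common_mem_of_pairs`).
-/

namespace CrossIntersect

open Finset

/-! ### Weights and products of binomial coefficients -/

/-- The number of ways to enlarge a `k`-element set by elements of a disjoint `N`-element set so
that the resulting size lies in `M`. -/
def extCount (N : ℕ) (M : Finset ℕ) (k : ℕ) : ℕ :=
  ∑ i ∈ M, if k ≤ i then N.choose (i - k) else 0

theorem extCount_succ (N : ℕ) (M : Finset ℕ) (k : ℕ) :
    extCount (N + 1) M k = extCount N M k + extCount N M (k + 1) := by
  unfold extCount
  rw [← sum_add_distrib]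
  refine sum_congr rfl fun i _ => ?_
  rcases lt_trichotomy i k with h | rfl | h
  · rw [if_neg (by omega), if_neg (by omega), if_neg (by omega)]
  · simp
  · obtain ⟨d, rfl⟩ : ∃ d, i = k + 1 + d := ⟨i - (k + 1), by omega⟩
    rw [if_pos (by omega), if_pos (by omega), if_pos (by omega),
      show k + 1 + d - k = d + 1 by omega, show k + 1 + d - (k + 1) = d by omega,
      Nat.choose_succ_succ]
    ring

theorem extCount_zero (M : Finset ℕ) (k : ℕ) : extCount 0 M k = if k ∈ M then 1 else 0 := by
  unfold extCount
  rw [← sum_ite_eq M k (fun _ => 1)]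
  refine sum_congr rfl fun i _ => ?_
  rcases lt_trichotomy i k with h | rfl | h
  · rw [if_neg (by omega), if_neg (by omega)]
  · simp
  · rw [if_pos h.le, if_neg (by omega), Nat.choose_eq_zero_of_lt (by omega)]

theorem extCount_pos {N k i : ℕ} {M : Finset ℕ} (hi : i ∈ M) (hk : k ≤ i) (hN : i ≤ N + k) :
    0 < extCount N M k := by
  refine sum_pos' (fun _ _ => Nat.zero_le _) ⟨i, hi, ?_⟩
  rw [if_pos hk]
  exact Nat.choose_pos (by omega)

theorem exists_of_extCount_pos {N k : ℕ} {M : Finset ℕ} (h : 0 < extCount N M k) :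
    ∃ i ∈ M, k ≤ i ∧ i ≤ N + k := by
  obtain ⟨i, hi, h'⟩ := exists_ne_zero_of_sum_ne_zero h.ne'
  by_cases hk : k ≤ i
  · rw [if_pos hk, Nat.choose_ne_zero_iff] at h'
    exact ⟨i, hi, hk, by omega⟩
  · simp [hk] at h'

theorem extCount_self {N r : ℕ} {M : Finset ℕ} (hr : IsGreatest (M : Set ℕ) r) :
    extCount N M r = 1 := by
  unfold extCount
  rw [sum_eq_single r]
  · simp
  · intro i hi hne
    have : i ≤ r := hr.2 hi
    rw [if_neg (by omega)]
  · exact fun h => absurd hr.1 h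

theorem choose_mul_choose_le {N p q : ℕ} (h : p + q + 1 ≤ N) :
    N.choose p * N.choose q ≤ N.choose (p + 1) * N.choose (q + 1) := by
  have h1 := Nat.choose_succ_right_eq N p
  have h2 := Nat.choose_succ_right_eq N q
  have h3 : (p + 1) * (q + 1) ≤ (N - p) * (N - q) := by
    rw [mul_comm (p + 1)]
    exact Nat.mul_le_mul (by omega) (by omega)
  refine Nat.le_of_mul_le_mul_left (c := (p + 1) * (q + 1)) ?_ (by positivity)
  calc (p + 1) * (q + 1) * (N.choose p * N.choose q)
      ≤ (N - p) * (N - q) * (N.choose p * N.choose q) := Nat.mul_le_mul_right _ h3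
    _ = (N.choose p * (N - p)) * (N.choose q * (N - q)) := by ring
    _ = _ := by rw [← h1, ← h2]; ring

theorem choose_mul_choose_lt {N p q : ℕ} (h : p + q + 1 < N) :
    N.choose p * N.choose q < N.choose (p + 1) * N.choose (q + 1) := by
  have h1 := Nat.choose_succ_right_eq N p
  have h2 := Nat.choose_succ_right_eq N q
  have h3 : (p + 1) * (q + 1) < (N - p) * (N - q) := by
    rw [mul_comm (p + 1)]
    exact Nat.mul_lt_mul'' (by omega) (by omega)
  have hp : 0 < N.choose p * N.choose q :=
    Nat.mul_pos (Nat.choose_pos (by omega)) (Nat.choose_pos (by omega))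
  refine Nat.lt_of_mul_lt_mul_left (a := (p + 1) * (q + 1)) ?_
  calc (p + 1) * (q + 1) * (N.choose p * N.choose q)
      < (N - p) * (N - q) * (N.choose p * N.choose q) := Nat.mul_lt_mul_of_pos_right h3 hp
    _ = (N.choose p * (N - p)) * (N.choose q * (N - q)) := by ring
    _ = _ := by rw [← h1, ← h2]; ring

theorem extCount_mul_le {N u v r s : ℕ} {R S : Finset ℕ} (hr : ∀ i ∈ R, i ≤ r)
    (hs : ∀ i ∈ S, i ≤ s) (h : r + s ≤ N + u + v + 1) :
    extCount N R (u + 1) * extCount N S (v + 1) ≤ extCount N R u * extCount N S v := by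
  unfold extCount
  rw [sum_mul_sum, sum_mul_sum]
  refine sum_le_sum fun i hi => sum_le_sum fun j hj => ?_
  have := hr i hi
  have := hs j hj
  by_cases h1 : u + 1 ≤ i
  · by_cases h2 : v + 1 ≤ j
    · rw [if_pos h1, if_pos h2, if_pos (by omega), if_pos (by omega),
        show i - u = i - (u + 1) + 1 by omega, show j - v = j - (v + 1) + 1 by omega]
      exact choose_mul_choose_le (by omega)
    · rw [if_neg h2]; simp
  · rw [if_neg h1]; simp

theorem extCount_mul_lt {N u v r s : ℕ} {R S : Finset ℕ} (hr : ∀ i ∈ R, i ≤ r)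
    (hs : ∀ i ∈ S, i ≤ s) (h : r + s ≤ N + u + v)
    (hu : 0 < extCount N R u) (hv : 0 < extCount N S v) :
    extCount N R (u + 1) * extCount N S (v + 1) < extCount N R u * extCount N S v := by
  obtain ⟨i₀, hi₀, hui, hiN⟩ := exists_of_extCount_pos hu
  obtain ⟨j₀, hj₀, hvj, hjN⟩ := exists_of_extCount_pos hv
  have key : ∀ i ∈ R, ∀ j ∈ S,
      (if u + 1 ≤ i then N.choose (i - (u + 1)) else 0) *
        (if v + 1 ≤ j then N.choose (j - (v + 1)) else 0) ≤
      (if u ≤ i then N.choose (i - u) else 0) * (if v ≤ j then N.choose (j - v) else 0) := by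
    intro i hi j hj
    have := hr i hi
    have := hs j hj
    by_cases h1 : u + 1 ≤ i
    · by_cases h2 : v + 1 ≤ j
      · rw [if_pos h1, if_pos h2, if_pos (by omega), if_pos (by omega),
          show i - u = i - (u + 1) + 1 by omega, show j - v = j - (v + 1) + 1 by omega]
        exact choose_mul_choose_le (by omega)
      · rw [if_neg h2]; simp
    · rw [if_neg h1]; simp
  unfold extCount
  rw [sum_mul_sum, sum_mul_sum]
  refine sum_lt_sum (fun i hi => sum_le_sum fun j hj => key i hi j hj) ⟨i₀, hi₀, ?_⟩
  refine sum_lt_sum (fun j hj => key i₀ hi₀ j hj) ⟨j₀, hj₀, ?_⟩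
  have := hr i₀ hi₀
  have := hs j₀ hj₀
  rw [if_pos hui, if_pos hvj]
  have hpos : 0 < N.choose (i₀ - u) * N.choose (j₀ - v) :=
    Nat.mul_pos (Nat.choose_pos (by omega)) (Nat.choose_pos (by omega))
  by_cases h1 : u + 1 ≤ i₀
  · by_cases h2 : v + 1 ≤ j₀
    · rw [if_pos h1, if_pos h2,
        show i₀ - u = i₀ - (u + 1) + 1 by omega, show j₀ - v = j₀ - (v + 1) + 1 by omega]
      exact choose_mul_choose_lt (by omega)
    · rw [if_neg h2]; simpa using hpos
  · rw [if_neg h1]; simpa using hpos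

/-- The sum of the values `w |A|` over the members `A` of a family. -/
def weight (w : ℕ → ℕ) (𝒜 : Finset (Finset ℕ)) : ℕ := ∑ A ∈ 𝒜, w A.card

theorem weight_mono (w : ℕ → ℕ) {𝒜 ℬ : Finset (Finset ℕ)} (h : 𝒜 ⊆ ℬ) :
    weight w 𝒜 ≤ weight w ℬ :=
  sum_le_sum_of_subset h

theorem eq_of_subset_of_weight_le {w : ℕ → ℕ} {𝒜 ℬ : Finset (Finset ℕ)} (h : 𝒜 ⊆ ℬ)
    (hpos : ∀ B ∈ ℬ, 0 < w B.card) (hw : weight w ℬ ≤ weight w 𝒜) : 𝒜 = ℬ := by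
  by_contra hne
  obtain ⟨B, hB, hB'⟩ := exists_of_ssubset (h.ssubset_of_ne hne)
  exact absurd (sum_lt_sum_of_subset (f := fun A : Finset ℕ => w A.card) h hB hB' (hpos B hB)
    fun _ _ _ => Nat.zero_le _) (not_lt.2 hw)

/-- Cross `t`-intersecting families of finite sets of natural numbers. -/
def Cross (t : ℕ) (𝒜 ℬ : Finset (Finset ℕ)) : Prop :=
  ∀ A ∈ 𝒜, ∀ B ∈ ℬ, t ≤ (A ∩ B).card

theorem Cross.symm {t : ℕ} {𝒜 ℬ : Finset (Finset ℕ)} (h : Cross t 𝒜 ℬ) : Cross t ℬ 𝒜 :=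
  fun B hB A hA => by rw [inter_comm]; exact h A hA B hB

/-! ### Shifting -/

/-- A family of subsets of `range a` is shifted if replacing an element of a member by a smaller
one always gives a member again. -/
def IsShifted (a : ℕ) (𝒜 : Finset (Finset ℕ)) : Prop :=
  ∀ A ∈ 𝒜, ∀ i j, i < j → j < a → j ∈ A → i ∉ A → insert i (A.erase j) ∈ 𝒜

/-- The action of the `(i, j)`-shift of `𝒜` on a member `A`: replace `j` by `i`, provided that this
makes sense and gives a set outside `𝒜`. -/
def shiftMap (i j : ℕ) (𝒜 : Finset (Finset ℕ)) (A : Finset ℕ) : Finset ℕ :=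
  if j ∈ A ∧ i ∉ A ∧ insert i (A.erase j) ∉ 𝒜 then insert i (A.erase j) else A

theorem card_insert_erase {i j : ℕ} {A : Finset ℕ} (hj : j ∈ A) (hi : i ∉ A) :
    (insert i (A.erase j)).card = A.card := by
  rw [card_insert_of_notMem (fun h => hi (mem_of_mem_erase h)), card_erase_add_one hj]

theorem card_shiftMap (i j : ℕ) (𝒜 : Finset (Finset ℕ)) (A : Finset ℕ) :
    (shiftMap i j 𝒜 A).card = A.card := by
  unfold shiftMap
  split_ifs with h
  · exact card_insert_erase h.1 h.2.1
  · rfl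

theorem shiftMap_injOn (i j : ℕ) (𝒜 : Finset (Finset ℕ)) :
    Set.InjOn (shiftMap i j 𝒜) (𝒜 : Set (Finset ℕ)) := by
  intro A hA B hB hAB
  have inv : ∀ C : Finset ℕ, j ∈ C → i ∉ C → insert j ((insert i (C.erase j)).erase i) = C := by
    intro C hj hi
    rw [erase_insert (fun h => hi (mem_of_mem_erase h)), insert_erase hj]
  unfold shiftMap at hAB
  split_ifs at hAB with h1 h2 h2
  · rw [← inv A h1.1 h1.2.1, hAB, inv B h2.1 h2.2.1]
  · exact absurd (hAB ▸ hB) h1.2.2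
  · exact absurd (hAB ▸ hA) h2.2.2
  · exact hAB

theorem weight_shift (w : ℕ → ℕ) (i j : ℕ) (𝒜 : Finset (Finset ℕ)) :
    weight w (𝒜.image (shiftMap i j 𝒜)) = weight w 𝒜 := by
  unfold weight
  rw [sum_image (shiftMap_injOn i j 𝒜)]
  simp only [card_shiftMap]

theorem shiftMap_subset_range {a i j : ℕ} (hij : i < j) {𝒜 : Finset (Finset ℕ)} {A : Finset ℕ}
    (hA : A ⊆ range a) : shiftMap i j 𝒜 A ⊆ range a := by
  unfold shiftMap
  split_ifs with h
  · have hj := mem_range.1 (hA h.1)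
    exact insert_subset (mem_range.2 (hij.trans hj)) ((erase_subset _ _).trans hA)
  · exact hA

theorem Cross.shift_left_changed {t i j : ℕ} {𝒜 ℬ : Finset (Finset ℕ)} (h : Cross t 𝒜 ℬ)
    {A B : Finset ℕ} (hA : A ∈ 𝒜) (hB : B ∈ ℬ) (hjA : j ∈ A) (hiA : i ∉ A)
    (hu : ¬ (j ∈ B ∧ i ∉ B ∧ insert i (B.erase j) ∉ ℬ)) :
    t ≤ (insert i (A.erase j) ∩ B).card := by
  by_cases hjB : j ∈ B
  · by_cases hiB : i ∈ B
    · have e : insert i (A.erase j) ∩ B = insert i ((A ∩ B).erase j) := by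
        ext x; simp only [mem_inter, mem_insert, mem_erase]
        constructor
        · tauto
        · rintro (rfl | hx) <;> tauto
      rw [e, card_insert_erase (mem_inter.2 ⟨hjA, hjB⟩) (fun hx => hiA (mem_inter.1 hx).1)]
      exact h A hA B hB
    · have hB' : insert i (B.erase j) ∈ ℬ := by tauto
      have e : insert i (A.erase j) ∩ B = A ∩ insert i (B.erase j) := by
        ext x; simp only [mem_inter, mem_insert, mem_erase]
        constructor
        · rintro ⟨rfl | hx, hxB⟩ <;> tauto
        · rintro ⟨hxA, rfl | hx⟩ <;> tauto
      rw [e]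
      exact h A hA _ hB'
  · refine (h A hA B hB).trans (card_le_card fun x hx => ?_)
    rw [mem_inter] at hx ⊢
    exact ⟨mem_insert_of_mem (mem_erase.2 ⟨fun e => hjB (e ▸ hx.2), hx.1⟩), hx.2⟩

theorem Cross.shift {t : ℕ} (i j : ℕ) {𝒜 ℬ : Finset (Finset ℕ)} (h : Cross t 𝒜 ℬ) :
    Cross t (𝒜.image (shiftMap i j 𝒜)) (ℬ.image (shiftMap i j ℬ)) := by
  intro A' hA' B' hB'
  obtain ⟨A, hA, rfl⟩ := mem_image.1 hA'
  obtain ⟨B, hB, rfl⟩ := mem_image.1 hB'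
  unfold shiftMap
  split_ifs with h1 h2 h2
  · have e : insert i (A.erase j) ∩ insert i (B.erase j) = insert i ((A ∩ B).erase j) := by
      ext x; simp only [mem_inter, mem_insert, mem_erase]; tauto
    rw [e, card_insert_erase (mem_inter.2 ⟨h1.1, h2.1⟩) (fun hx => h1.2.1 (mem_inter.1 hx).1)]
    exact h A hA B hB
  · exact h.shift_left_changed hA hB h1.1 h1.2.1 h2
  · rw [inter_comm]
    exact h.symm.shift_left_changed hB hA h2.1 h2.2.1 h1
  · exact h A hA B hB

/-- The sum of all elements of all members, the quantity that every effective shift decreases. -/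
def elementSum (𝒜 : Finset (Finset ℕ)) : ℕ := ∑ A ∈ 𝒜, ∑ x ∈ A, x

theorem sum_shiftMap_le {i j : ℕ} (hij : i < j) (𝒜 : Finset (Finset ℕ)) (A : Finset ℕ) :
    ∑ x ∈ shiftMap i j 𝒜 A, x ≤ ∑ x ∈ A, x := by
  unfold shiftMap
  split_ifs with h
  · rw [sum_insert (fun hx => h.2.1 (mem_of_mem_erase hx))]
    have := sum_erase_add A (fun x => x) h.1
    omega
  · rfl

theorem elementSum_shift_le {i j : ℕ} (hij : i < j) (𝒜 : Finset (Finset ℕ)) :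
    elementSum (𝒜.image (shiftMap i j 𝒜)) ≤ elementSum 𝒜 := by
  unfold elementSum
  rw [sum_image (shiftMap_injOn i j 𝒜)]
  exact sum_le_sum fun A _ => sum_shiftMap_le hij 𝒜 A

theorem elementSum_shift_lt {i j : ℕ} (hij : i < j) {𝒜 : Finset (Finset ℕ)} {A : Finset ℕ}
    (hA : A ∈ 𝒜) (hj : j ∈ A) (hi : i ∉ A) (hn : insert i (A.erase j) ∉ 𝒜) :
    elementSum (𝒜.image (shiftMap i j 𝒜)) < elementSum 𝒜 := by
  unfold elementSum
  rw [sum_image (shiftMap_injOn i j 𝒜)]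
  refine sum_lt_sum (fun A _ => sum_shiftMap_le hij 𝒜 A) ⟨A, hA, ?_⟩
  rw [shiftMap, if_pos ⟨hj, hi, hn⟩, sum_insert (fun hx => hi (mem_of_mem_erase hx))]
  have := sum_erase_add A (fun x => x) hj
  omega

/-- Cross `t`-intersecting families can be replaced by shifted ones without changing how many
members of each size they have; the latter is expressed through all weights at once. -/
theorem exists_shifted {a t : ℕ} (𝒜 ℬ : Finset (Finset ℕ)) (hA : ∀ A ∈ 𝒜, A ⊆ range a)
    (hB : ∀ B ∈ ℬ, B ⊆ range a) (h : Cross t 𝒜 ℬ) :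
    ∃ 𝒜' ℬ' : Finset (Finset ℕ), (∀ A ∈ 𝒜', A ⊆ range a) ∧ (∀ B ∈ ℬ', B ⊆ range a) ∧
      Cross t 𝒜' ℬ' ∧ IsShifted a 𝒜' ∧ IsShifted a ℬ' ∧
      (∀ w, weight w 𝒜' = weight w 𝒜) ∧ (∀ w, weight w ℬ' = weight w ℬ) := by
  induction hm : elementSum 𝒜 + elementSum ℬ using Nat.strong_induction_on generalizing 𝒜 ℬ with
  | _ m ih =>
    by_cases hsh : IsShifted a 𝒜 ∧ IsShifted a ℬ
    · exact ⟨𝒜, ℬ, hA, hB, h, hsh.1, hsh.2, fun _ => rfl, fun _ => rfl⟩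
    · obtain ⟨i, j, hij, hlt⟩ : ∃ i j, i < j ∧
          elementSum (𝒜.image (shiftMap i j 𝒜)) + elementSum (ℬ.image (shiftMap i j ℬ)) < m := by
        rw [not_and_or] at hsh
        rcases hsh with hsh | hsh
        · unfold IsShifted at hsh
          push Not at hsh
          obtain ⟨A, hA', i, j, hij, -, hj, hi, hn⟩ := hsh
          have h1 := elementSum_shift_lt hij hA' hj hi hn
          have h2 := elementSum_shift_le hij ℬ
          exact ⟨i, j, hij, by omega⟩
        · unfold IsShifted at hsh
          push Not at hsh
          obtain ⟨A, hA', i, j, hij, -, hj, hi, hn⟩ := hsh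
          have h1 := elementSum_shift_lt hij hA' hj hi hn
          have h2 := elementSum_shift_le hij 𝒜
          exact ⟨i, j, hij, by omega⟩
      obtain ⟨𝒜', ℬ', h1, h2, h3, h4, h5, h6, h7⟩ := ih _ hlt (𝒜.image (shiftMap i j 𝒜))
        (ℬ.image (shiftMap i j ℬ))
        (fun A' hA' => by
          obtain ⟨A, hA'', rfl⟩ := mem_image.1 hA'
          exact shiftMap_subset_range hij (hA A hA''))
        (fun A' hA' => by
          obtain ⟨A, hA'', rfl⟩ := mem_image.1 hA'
          exact shiftMap_subset_range hij (hB A hA''))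
        (h.shift i j) rfl
      exact ⟨𝒜', ℬ', h1, h2, h3, h4, h5, fun w => (h6 w).trans (weight_shift w i j 𝒜),
        fun w => (h7 w).trans (weight_shift w i j ℬ)⟩

/-! ### Critical sets -/

/-- The members of `𝒜` for which the top element `a` is indispensable: it lies in an intersection
of minimum size `t` with some member of `ℬ`. -/
def critical (a t : ℕ) (𝒜 ℬ : Finset (Finset ℕ)) : Finset (Finset ℕ) :=
  𝒜.filter fun U => a ∈ U ∧ ∃ V ∈ ℬ, a ∈ V ∧ (U ∩ V).card = t

theorem card_add_card_of_critical {a t : ℕ} {𝒜 ℬ : Finset (Finset ℕ)}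
    (hA : ∀ A ∈ 𝒜, A ⊆ range (a + 1)) (hB : ∀ B ∈ ℬ, B ⊆ range (a + 1)) (h : Cross t 𝒜 ℬ)
    (hsh : IsShifted (a + 1) 𝒜) {U V : Finset ℕ} (hU : U ∈ 𝒜) (hV : V ∈ ℬ) (haU : a ∈ U)
    (haV : a ∈ V) (ht : (U ∩ V).card = t) : U.card + V.card = a + 1 + t := by
  have hun : U ∪ V = range (a + 1) := by
    refine Subset.antisymm (union_subset (hA U hU) (hB V hV)) fun x hx => ?_
    by_contra hxn
    rw [mem_union, not_or] at hxn
    have hxa : x < a := by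
      have h1 := mem_range.1 hx
      have h2 : x ≠ a := fun e => hxn.1 (e ▸ haU)
      omega
    have h1 := h _ (hsh U hU x a hxa (Nat.lt_succ_self a) haU hxn.1) V hV
    have e : insert x (U.erase a) ∩ V = (U ∩ V).erase a := by
      rw [insert_inter_of_notMem hxn.2, erase_inter]
    rw [e] at h1
    have := card_erase_lt_of_mem (mem_inter.2 ⟨haU, haV⟩)
    omega
  have := card_union_add_card_inter U V
  rw [hun, card_range, ht] at this
  omega

theorem erase_notMem_of_critical {a t : ℕ} {𝒜 ℬ : Finset (Finset ℕ)} (h : Cross t 𝒜 ℬ)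
    {U : Finset ℕ} (hU : U ∈ critical a t 𝒜 ℬ) : U.erase a ∉ 𝒜 := by
  obtain ⟨-, haU, V, hV, haV, ht⟩ := mem_filter.1 hU
  intro hmem
  have h1 := h _ hmem V hV
  rw [erase_inter] at h1
  have := card_erase_lt_of_mem (mem_inter.2 ⟨haU, haV⟩)
  omega

/-- Removing `a` from the members of `𝒦` and counting each resulting set `W` with the weights of
both `W` and `W ∪ {a}` does not lose weight, and gains the weight of every new set `U \ {a}`. -/
theorem weight_add_le_weight_image_erase (w : ℕ → ℕ) (a : ℕ) {𝒦 ℰ : Finset (Finset ℕ)}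
    (hE : ℰ ⊆ 𝒦) (haE : ∀ U ∈ ℰ, a ∈ U) (hnot : ∀ U ∈ ℰ, U.erase a ∉ 𝒦) :
    weight w 𝒦 + ∑ U ∈ ℰ, w (U.card - 1) ≤
      weight (fun k => w k + w (k + 1)) (𝒦.image fun U => U.erase a) := by
  set 𝒯 := 𝒦.image fun U => U.erase a with h𝒯
  have ha𝒯 : ∀ W ∈ 𝒯, a ∉ W := by
    intro W hW
    obtain ⟨U, -, rfl⟩ := mem_image.1 hW
    exact notMem_erase a U
  have hdisj : Disjoint 𝒯 (𝒯.image (insert a)) := by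
    rw [disjoint_left]
    intro W hW hW'
    obtain ⟨W', -, rfl⟩ := mem_image.1 hW'
    exact ha𝒯 _ hW (mem_insert_self _ _)
  have hT : weight (fun k => w k + w (k + 1)) 𝒯 = weight w (𝒯 ∪ 𝒯.image (insert a)) := by
    have hi : ∑ W ∈ 𝒯.image (insert a), w W.card = ∑ W ∈ 𝒯, w (W.card + 1) := by
      rw [sum_image fun W hW W' hW' hWW => by
        rw [← erase_insert (ha𝒯 W hW), hWW, erase_insert (ha𝒯 W' hW')]]
      exact sum_congr rfl fun W hW => by rw [card_insert_of_notMem (ha𝒯 W hW)]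
    rw [weight, weight, sum_union hdisj, hi, sum_add_distrib]
  have hEi : ∑ U ∈ ℰ, w (U.card - 1) = weight w (ℰ.image fun U => U.erase a) := by
    unfold weight
    rw [sum_image]
    · exact sum_congr rfl fun U hU => by rw [card_erase_of_mem (haE U hU)]
    · intro U hU U' hU' hUU
      rw [← insert_erase (haE U hU), ← insert_erase (haE U' hU')]
      exact congrArg _ hUU
  have hd : Disjoint 𝒦 (ℰ.image fun U => U.erase a) := by
    rw [disjoint_left]
    intro W hW hW'
    obtain ⟨U, hU, rfl⟩ := mem_image.1 hW'
    exact hnot U hU hW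
  rw [hT, hEi, weight, weight, ← sum_union hd]
  refine weight_mono w (union_subset (fun U hU => ?_) ?_)
  · have hm : U.erase a ∈ 𝒯 := mem_image_of_mem _ hU
    by_cases ha : a ∈ U
    · exact mem_union_right _ (mem_image.2 ⟨_, hm, insert_erase ha⟩)
    · rw [erase_eq_of_notMem ha] at hm
      exact mem_union_left _ hm
  · exact (image_subset_image hE).trans subset_union_left

theorem sum_filter_key {α : Type*} (P : Finset α) (key : α → ℕ) (m : ℕ)
    (hkey : ∀ x ∈ P, key x < m) (D : ℕ → Prop) [DecidablePred D] (f : ℕ → ℕ) :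
    ∑ x ∈ P with D (key x), f (key x) =
      ∑ u ∈ range m, if D u then (P.filter fun x => key x = u).card * f u else 0 := by
  rw [sum_filter, ← sum_fiberwise_of_maps_to (t := range m) (g := key)
    (fun x hx => mem_range.2 (hkey x hx))]
  refine sum_congr rfl fun u _ => ?_
  rw [sum_congr rfl (g := fun _ => if D u then f u else 0)
    (fun x hx => by rw [(mem_filter.1 hx).2]), sum_const, smul_eq_mul, mul_ite, mul_zero]

/-- If removing `p` sets of weight `α` costs at least the gain of `q` sets of weight `β'`, then
removing `q` sets of weight `β` costs at most the gain of `p` sets of weight `α'`. -/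
theorem exchange_le {p q α β α' β' : ℕ} (hpq : (p = 0 ∧ q = 0) ∨ (0 < p ∧ 0 < q ∧ 0 < α ∧ 0 < β))
    (h : 0 < p → α * β ≤ α' * β') (hle : q * β' ≤ p * α) : q * β ≤ p * α' := by
  rcases hpq with ⟨rfl, rfl⟩ | ⟨hp, hq, hα, hβ⟩
  · simp
  · by_contra! hlt
    have h1 : p * q * (α * β) ≤ p * q * (α' * β') := Nat.mul_le_mul_left _ (h hp)
    have h2 : (q * β') * (p * α') ≤ (p * α) * (p * α') := Nat.mul_le_mul_right _ hle
    have h3 : (p * α) * (p * α') < (p * α) * (q * β) :=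
      Nat.mul_lt_mul_of_pos_left hlt (Nat.mul_pos hp hα)
    have : (p * α) * (q * β) = p * q * (α * β) := by ring
    have : (q * β') * (p * α') = p * q * (α' * β') := by ring
    omega

theorem exchange_lt {p q α β α' β' : ℕ} (hp : 0 < p) (hq : 0 < q)
    (h : α * β < α' * β') (hle : q * β' ≤ p * α) : q * β < p * α' := by
  by_contra! hlt
  have h1 : p * q * (α * β) < p * q * (α' * β') :=
    Nat.mul_lt_mul_of_pos_left h (Nat.mul_pos hp hq)
  have h2 : (q * β') * (p * α') ≤ (p * α) * (q * β) := Nat.mul_le_mul hle hlt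
  have : (p * α) * (q * β) = p * q * (α * β) := by ring
  have : (q * β') * (p * α') = p * q * (α' * β') := by ring
  omega

theorem eq_singleton_range_of_forall_mem {a : ℕ} {𝒜 : Finset (Finset ℕ)}
    (hA : ∀ A ∈ 𝒜, A ⊆ range (a + 1)) (hsh : IsShifted (a + 1) 𝒜) (hne : 𝒜.Nonempty)
    (ha : ∀ A ∈ 𝒜, a ∈ A) : 𝒜 = {range (a + 1)} := by
  refine eq_singleton_iff_nonempty_unique_mem.2 ⟨hne, fun A hA' => ?_⟩
  refine Subset.antisymm (hA A hA') fun x hx => ?_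
  by_contra hxA
  have hne : x ≠ a := fun e => hxA (e ▸ ha A hA')
  have hxa : x < a := by have := mem_range.1 hx; omega
  have := ha _ (hsh A hA' x a hxa (Nat.lt_succ_self a) (ha A hA') hxA)
  rw [mem_insert, mem_erase] at this
  tauto

/-! ### Removing the last point -/

/-- The exchange step. Shifted cross `t`-intersecting families on `a + 1` points are projected to
cross `t`-intersecting families on `a` points without loss of weight. For each `u`, either the
critical `u`-sets of one family or the critical `(a + 1 + t - u)`-sets of the other are discarded;
log-concavity of the binomial coefficients guarantees that one of the two choices is affordable. -/
theorem exists_projection {N a t r s : ℕ} {R S : Finset ℕ} (hr : ∀ i ∈ R, i ≤ r)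
    (hs : ∀ i ∈ S, i ≤ s) (hn : r + s + 1 ≤ N + (a + 1) + t) {𝒜 ℬ : Finset (Finset ℕ)}
    (hA : ∀ A ∈ 𝒜, A ⊆ range (a + 1)) (hB : ∀ B ∈ ℬ, B ⊆ range (a + 1)) (h : Cross t 𝒜 ℬ)
    (hshA : IsShifted (a + 1) 𝒜) (hshB : IsShifted (a + 1) ℬ)
    (hposA : ∀ A ∈ 𝒜, 0 < extCount N R A.card) (hposB : ∀ B ∈ ℬ, 0 < extCount N S B.card)
    (hneA : 𝒜.Nonempty) (hneB : ℬ.Nonempty)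
    (hA1 : 𝒜 ≠ {range (a + 1)}) (hB1 : ℬ ≠ {range (a + 1)}) :
    ∃ 𝒜' ℬ' : Finset (Finset ℕ), (∀ A ∈ 𝒜', A ⊆ range a) ∧ (∀ B ∈ ℬ', B ⊆ range a) ∧
      Cross t 𝒜' ℬ' ∧ 𝒜'.Nonempty ∧ ℬ'.Nonempty ∧
      (∀ A ∈ 𝒜', 0 < extCount (N + 1) R A.card) ∧ (∀ B ∈ ℬ', 0 < extCount (N + 1) S B.card) ∧
      weight (extCount N R) 𝒜 + weight (extCount N S) ℬ ≤
        weight (extCount (N + 1) R) 𝒜' + weight (extCount (N + 1) S) ℬ' ∧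
      (r + s + 2 ≤ N + (a + 1) + t →
        weight (extCount N R) 𝒜 + weight (extCount N S) ℬ <
          weight (extCount (N + 1) R) 𝒜' + weight (extCount (N + 1) S) ℬ' ∨
        (𝒜' = (𝒜.image fun U => U.erase a) ∧ ℬ' = (ℬ.image fun U => U.erase a))) := by
  classical
  set α := extCount N R with hα
  set β := extCount N S with hβ
  set P := critical a t 𝒜 ℬ with hP
  set Q := critical a t ℬ 𝒜 with hQ
  have hPmem : ∀ U ∈ P, U ∈ 𝒜 ∧ a ∈ U ∧ ∃ V ∈ Q, U.card + V.card = a + 1 + t := by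
    intro U hU
    obtain ⟨hUA, haU, V, hV, haV, ht⟩ := mem_filter.1 hU
    exact ⟨hUA, haU, V, mem_filter.2 ⟨hV, haV, U, hUA, haU, by rw [inter_comm]; exact ht⟩,
      card_add_card_of_critical hA hB h hshA hUA hV haU haV ht⟩
  have hQmem : ∀ V ∈ Q, V ∈ ℬ ∧ a ∈ V ∧ ∃ U ∈ P, U.card + V.card = a + 1 + t := by
    intro V hV
    obtain ⟨hVB, haV, U, hU, haU, ht⟩ := mem_filter.1 hV
    rw [inter_comm] at ht
    exact ⟨hVB, haV, U, mem_filter.2 ⟨hU, haU, V, hVB, haV, ht⟩,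
      card_add_card_of_critical hA hB h hshA hU hVB haU haV ht⟩
  have hcardA : ∀ U ∈ 𝒜, U.card ≤ a + 1 := fun U hU => by
    simpa using card_le_card (hA U hU)
  have hcardB : ∀ V ∈ ℬ, V.card ≤ a + 1 := fun V hV => by
    simpa using card_le_card (hB V hV)
  -- the size of the critical sets of `𝒜` that are matched to a critical set `V` of `ℬ`
  set key : Finset ℕ → ℕ := fun V => a + 1 + t - V.card with hkey
  set p : ℕ → ℕ := fun u => (P.filter fun U => U.card = u).card with hp
  set q : ℕ → ℕ := fun u => (Q.filter fun V => key V = u).card with hq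
  have hpq : ∀ u, (p u = 0 ∧ q u = 0) ∨
      (0 < p u ∧ 0 < q u ∧ 0 < α u ∧ 0 < β (a + 1 + t - u) ∧ 1 ≤ u ∧ u ≤ a + t) := by
    intro u
    by_cases hU : ∃ U ∈ P, U.card = u
    · obtain ⟨U, hU, rfl⟩ := hU
      obtain ⟨hUA, haU, V, hV, hUV⟩ := hPmem U hU
      obtain ⟨hVB, haV, -⟩ := hQmem V hV
      have hVu : a + 1 + t - U.card = V.card := by omega
      have h1 : 0 < U.card := card_pos.2 ⟨a, haU⟩
      have h2 : 0 < V.card := card_pos.2 ⟨a, haV⟩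
      refine Or.inr ⟨card_pos.2 ⟨U, mem_filter.2 ⟨hU, rfl⟩⟩, card_pos.2 ⟨V, mem_filter.2 ⟨hV, ?_⟩⟩,
        hposA U hUA, ?_, h1, by omega⟩
      · simp only [hkey]; omega
      · rw [hVu]; exact hposB V hVB
    · refine Or.inl ⟨card_eq_zero.2 (filter_eq_empty_iff.2 fun U hU' e => hU ⟨U, hU', e⟩),
        card_eq_zero.2 (filter_eq_empty_iff.2 fun V hV e => hU ?_)⟩
      obtain ⟨-, -, U, hU', hUV⟩ := hQmem V hV
      exact ⟨U, hU', by simp only [hkey] at e; omega⟩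
  have hmul : ∀ u, 1 ≤ u → u ≤ a + t →
      α u * β (a + 1 + t - u) ≤ α (u - 1) * β (a + 1 + t - u - 1) := by
    intro u h1 h2
    have := extCount_mul_le (N := N) (u := u - 1) (v := a + 1 + t - u - 1) hr hs (by omega)
    rwa [show u - 1 + 1 = u by omega, show a + 1 + t - u - 1 + 1 = a + 1 + t - u by omega] at this
  -- the sizes `u` for which the critical `u`-sets of `𝒜` are the ones to be discarded
  set D : ℕ → Prop := fun u => p u * α u < q u * β (a + 1 + t - u - 1) with hD
  set 𝒦 := 𝒜.filter fun U => ¬ (U ∈ P ∧ D U.card) with h𝒦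
  set ℒ := ℬ.filter fun V => ¬ (V ∈ Q ∧ ¬ D (key V)) with hℒ
  have hPA : P ⊆ 𝒜 := filter_subset _ _
  have hQB : Q ⊆ ℬ := filter_subset _ _
  have hwA : weight α 𝒜 = weight α 𝒦 + ∑ U ∈ P with D U.card, α U.card := by
    have e : (𝒜.filter fun U => U ∈ P ∧ D U.card) = P.filter fun U => D U.card := by
      ext U; simp only [mem_filter]
      exact ⟨fun hh => hh.2, fun hh => ⟨hPA hh.1, hh⟩⟩
    rw [weight, ← sum_filter_add_sum_filter_not 𝒜 (fun U => U ∈ P ∧ D U.card), e, add_comm]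
    rfl
  have hwB : weight β ℬ = weight β ℒ + ∑ V ∈ Q with ¬ D (key V), β V.card := by
    have e : (ℬ.filter fun V => V ∈ Q ∧ ¬ D (key V)) = Q.filter fun V => ¬ D (key V) := by
      ext V; simp only [mem_filter]
      exact ⟨fun hh => hh.2, fun hh => ⟨hQB hh.1, hh⟩⟩
    rw [weight, ← sum_filter_add_sum_filter_not ℬ (fun V => V ∈ Q ∧ ¬ D (key V)), e, add_comm]
    rfl
  have hgA := weight_add_le_weight_image_erase α a (𝒦 := 𝒦) (ℰ := P.filter fun U => ¬ D U.card)
    (fun U hU => by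
      obtain ⟨h1, h2⟩ := mem_filter.1 hU
      exact mem_filter.2 ⟨hPA h1, fun hh => h2 hh.2⟩)
    (fun U hU => (hPmem U (mem_filter.1 hU).1).2.1)
    (fun U hU hm => erase_notMem_of_critical h (mem_filter.1 hU).1 (mem_filter.1 hm).1)
  have hgB := weight_add_le_weight_image_erase β a (𝒦 := ℒ) (ℰ := Q.filter fun V => D (key V))
    (fun V hV => by
      obtain ⟨h1, h2⟩ := mem_filter.1 hV
      exact mem_filter.2 ⟨hQB h1, fun hh => hh.2 h2⟩)
    (fun V hV => (hQmem V (mem_filter.1 hV).1).2.1)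
    (fun V hV hm => erase_notMem_of_critical h.symm (mem_filter.1 hV).1 (mem_filter.1 hm).1)
  have eα : (fun k => α k + α (k + 1)) = extCount (N + 1) R :=
    funext fun k => (extCount_succ N R k).symm
  have eβ : (fun k => β k + β (k + 1)) = extCount (N + 1) S :=
    funext fun k => (extCount_succ N S k).symm
  rw [eα] at hgA
  rw [eβ] at hgB
  have hkP : ∀ U ∈ P, U.card < a + 2 := fun U hU => by
    have := hcardA U (hPA hU); omega
  have hkQ : ∀ V ∈ Q, key V < a + 2 := fun V hV => by
    obtain ⟨-, -, U, hU, hUV⟩ := hQmem V hV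
    have := hcardA U (hPA hU)
    simp only [hkey]; omega
  have hcQ : ∀ V ∈ Q, V.card = a + 1 + t - key V := fun V hV => by
    have := hcardB V (hQB hV)
    obtain ⟨-, -, U, hU, hUV⟩ := hQmem V hV
    simp only [hkey]; omega
  have sA : ∑ U ∈ P with D U.card, α U.card =
      ∑ u ∈ range (a + 2), if D u then p u * α u else 0 :=
    sum_filter_key P (fun U => U.card) (a + 2) hkP D α
  have sA' : ∑ U ∈ P with ¬ D U.card, α (U.card - 1) =
      ∑ u ∈ range (a + 2), if ¬ D u then p u * α (u - 1) else 0 :=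
    sum_filter_key P (fun U => U.card) (a + 2) hkP (fun u => ¬ D u) (fun u => α (u - 1))
  have sB : ∑ V ∈ Q with ¬ D (key V), β V.card =
      ∑ u ∈ range (a + 2), if ¬ D u then q u * β (a + 1 + t - u) else 0 := by
    rw [← sum_filter_key Q key (a + 2) hkQ (fun u => ¬ D u) (fun u => β (a + 1 + t - u))]
    exact sum_congr rfl fun V hV => by rw [hcQ V (mem_filter.1 hV).1]
  have sB' : ∑ V ∈ Q with D (key V), β (V.card - 1) =
      ∑ u ∈ range (a + 2), if D u then q u * β (a + 1 + t - u - 1) else 0 := by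
    rw [← sum_filter_key Q key (a + 2) hkQ D (fun u => β (a + 1 + t - u - 1))]
    exact sum_congr rfl fun V hV => by rw [hcQ V (mem_filter.1 hV).1]
  rw [sA] at hwA
  rw [sB] at hwB
  rw [sA'] at hgA
  rw [sB'] at hgB
  -- size by size, the loss is at most the gain
  have hterm : ∀ u, (if D u then p u * α u else 0) +
      (if ¬ D u then q u * β (a + 1 + t - u) else 0) ≤
      (if ¬ D u then p u * α (u - 1) else 0) +
      (if D u then q u * β (a + 1 + t - u - 1) else 0) := by
    intro u
    by_cases hDu : D u
    · simp only [hDu, if_true, not_true_eq_false, if_false, add_zero, zero_add]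
      exact le_of_lt hDu
    · simp only [hDu, if_false, not_false_eq_true, if_true, add_zero, zero_add]
      refine exchange_le ?_ (fun hpu => ?_) (not_lt.1 hDu)
      · exact (hpq u).imp id fun hh => ⟨hh.1, hh.2.1, hh.2.2.1, hh.2.2.2.1⟩
      · rcases hpq u with h0 | h0
        · omega
        · exact hmul u h0.2.2.2.2.1 h0.2.2.2.2.2
  refine ⟨𝒦.image fun U => U.erase a, ℒ.image fun U => U.erase a, ?_, ?_, ?_, ?_, ?_, ?_, ?_,
    ?_, ?_⟩
  · intro W hW
    obtain ⟨U, hU, rfl⟩ := mem_image.1 hW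
    intro x hx
    have h1 := mem_range.1 (hA U (mem_filter.1 hU).1 (mem_of_mem_erase hx))
    have h2 := ne_of_mem_erase hx
    exact mem_range.2 (by omega)
  · intro W hW
    obtain ⟨U, hU, rfl⟩ := mem_image.1 hW
    intro x hx
    have h1 := mem_range.1 (hB U (mem_filter.1 hU).1 (mem_of_mem_erase hx))
    have h2 := ne_of_mem_erase hx
    exact mem_range.2 (by omega)
  · intro W hW W' hW'
    obtain ⟨U, hU, rfl⟩ := mem_image.1 hW
    obtain ⟨V, hV, rfl⟩ := mem_image.1 hW'
    obtain ⟨hUA, hU2⟩ := mem_filter.1 hU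
    obtain ⟨hVB, hV2⟩ := mem_filter.1 hV
    have hUV := h U hUA V hVB
    have e : U.erase a ∩ V.erase a = (U ∩ V).erase a := by
      ext x; simp only [mem_inter, mem_erase]; tauto
    rw [e]
    by_cases ha : a ∈ U ∩ V
    · rw [card_erase_of_mem ha]
      by_contra hlt
      have ht : (U ∩ V).card = t := by omega
      rw [mem_inter] at ha
      have hUP : U ∈ P := mem_filter.2 ⟨hUA, ha.1, V, hVB, ha.2, ht⟩
      have hVQ : V ∈ Q := mem_filter.2 ⟨hVB, ha.2, U, hUA, ha.1, by rw [inter_comm]; exact ht⟩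
      have hc := card_add_card_of_critical hA hB h hshA hUA hVB ha.1 ha.2 ht
      have hk : key V = U.card := by simp only [hkey]; omega
      have h1 : ¬ D U.card := fun hh => hU2 ⟨hUP, hh⟩
      exact hV2 ⟨hVQ, hk ▸ h1⟩
    · rwa [erase_eq_of_notMem ha]
  · rw [image_nonempty, nonempty_iff_ne_empty]
    intro h0
    refine hA1 (eq_singleton_range_of_forall_mem hA hshA hneA fun U hU => ?_)
    have := filter_eq_empty_iff.1 h0 hU
    rw [not_not] at this
    exact (hPmem U this.1).2.1
  · rw [image_nonempty, nonempty_iff_ne_empty]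
    intro h0
    refine hB1 (eq_singleton_range_of_forall_mem hB hshB hneB fun U hU => ?_)
    have := filter_eq_empty_iff.1 h0 hU
    rw [not_not] at this
    exact (hQmem U this.1).2.1
  · intro W hW
    obtain ⟨U, hU, rfl⟩ := mem_image.1 hW
    have hU' : 0 < extCount N R U.card := hposA U (mem_filter.1 hU).1
    rw [extCount_succ]
    by_cases ha : a ∈ U
    · rw [card_erase_add_one ha]; omega
    · rw [erase_eq_of_notMem ha]; omega
  · intro W hW
    obtain ⟨U, hU, rfl⟩ := mem_image.1 hW
    have hU' : 0 < extCount N S U.card := hposB U (mem_filter.1 hU).1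
    rw [extCount_succ]
    by_cases ha : a ∈ U
    · rw [card_erase_add_one ha]; omega
    · rw [erase_eq_of_notMem ha]; omega
  · have := sum_le_sum fun u (_ : u ∈ range (a + 2)) => hterm u
    rw [sum_add_distrib, sum_add_distrib] at this
    omega
  · intro hn'
    by_cases hP0 : P = ∅
    · right
      have hQ0 : Q = ∅ := by
        refine eq_empty_of_forall_notMem fun V hV => ?_
        obtain ⟨-, -, U, hU, -⟩ := hQmem V hV
        rw [hP0] at hU
        exact notMem_empty _ hU
      constructor
      · rw [h𝒦, filter_true_of_mem fun U _ hh => by rw [hP0] at hh; exact notMem_empty _ hh.1]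
      · rw [hℒ, filter_true_of_mem fun U _ hh => by rw [hQ0] at hh; exact notMem_empty _ hh.1]
    · left
      obtain ⟨U, hU⟩ := nonempty_iff_ne_empty.2 hP0
      have hlt : ∑ u ∈ range (a + 2), ((if D u then p u * α u else 0) +
          (if ¬ D u then q u * β (a + 1 + t - u) else 0)) <
          ∑ u ∈ range (a + 2), ((if ¬ D u then p u * α (u - 1) else 0) +
          (if D u then q u * β (a + 1 + t - u - 1) else 0)) := by
        refine sum_lt_sum (fun u _ => hterm u) ⟨U.card, mem_range.2 (hkP U hU), ?_⟩
        have hpos : 0 < p U.card := card_pos.2 ⟨U, mem_filter.2 ⟨hU, rfl⟩⟩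
        rcases hpq U.card with h0 | ⟨h1, h2, h3, h4, h5, h6⟩
        · omega
        by_cases hDu : D U.card
        · simp only [hDu, if_true, not_true_eq_false, if_false, add_zero, zero_add]
          exact hDu
        · simp only [hDu, if_false, not_false_eq_true, if_true, add_zero, zero_add]
          refine exchange_lt h1 h2 ?_ (not_lt.1 hDu)
          have hpp := (Nat.mul_pos h3 h4).trans_le (hmul _ h5 h6)
          have := extCount_mul_lt (N := N) (u := U.card - 1) (v := a + 1 + t - U.card - 1) hr hs
            (by omega) (Nat.pos_of_mul_pos_right hpp) (Nat.pos_of_mul_pos_left hpp)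
          rwa [show U.card - 1 + 1 = U.card by omega,
            show a + 1 + t - U.card - 1 + 1 = a + 1 + t - U.card by omega] at this
      rw [sum_add_distrib, sum_add_distrib] at hlt
      omega

/-! ### The totals of the candidate pairs -/

theorem le_succ_of_increase_persists {f : ℕ → ℕ} {t r c : ℕ} (hf : ∀ a, t ≤ a → a + 2 ≤ r →
    f a ≤ f (a + 1) → f (a + 1) ≤ f (a + 2)) (htc : t ≤ c) (hc : f c ≤ f (c + 1)) {b : ℕ}
    (hcb : c ≤ b) (hbr : b + 1 ≤ r) : f b ≤ f (b + 1) := by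
  induction b, hcb using Nat.le_induction with
  | base => exact hc
  | succ b hb ih => exact hf b (by omega) hbr (ih (by omega))

theorem le_of_increase_persists {f : ℕ → ℕ} {t r c : ℕ} (hf : ∀ a, t ≤ a → a + 2 ≤ r →
    f a ≤ f (a + 1) → f (a + 1) ≤ f (a + 2)) (htc : t ≤ c) (hc : f c ≤ f (c + 1)) {b : ℕ}
    (hcb : c ≤ b) (hbr : b ≤ r) : f c ≤ f b := by
  induction b, hcb using Nat.le_induction with
  | base => exact le_rfl
  | succ b hb ih =>
    exact (ih (by omega)).trans (le_succ_of_increase_persists hf htc hc hb hbr)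

/-- A sequence whose increases persist takes its maximum at an end of the interval. -/
theorem le_max_ends {f : ℕ → ℕ} {t r c : ℕ} (hf : ∀ a, t ≤ a → a + 2 ≤ r →
    f a ≤ f (a + 1) → f (a + 1) ≤ f (a + 2)) (htc : t ≤ c) (hcr : c ≤ r) :
    f c ≤ f t ∨ f c ≤ f r := by
  induction c, htc using Nat.le_induction with
  | base => exact Or.inl le_rfl
  | succ c htc ih =>
    rcases le_or_gt (f c) (f (c + 1)) with h | h
    · rcases Nat.lt_or_ge (c + 1) r with h' | h'
      · exact Or.inr (le_of_increase_persists hf (by omega) (hf c htc h' h) hcr le_rfl)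
      · rw [show c + 1 = r by omega]; exact Or.inr le_rfl
    · exact (ih (by omega)).imp (fun h1 => h.le.trans h1) fun h1 => h.le.trans h1

/-- The strict form of `le_max_ends` at interior points. -/
theorem lt_max_ends {f : ℕ → ℕ} {t r c : ℕ} (hf : ∀ a, t ≤ a → a + 2 ≤ r →
    f a ≤ f (a + 1) → f (a + 1) < f (a + 2)) (htc : t < c) (hcr : c < r) :
    f c < f t ∨ f c < f r := by
  have hf' : ∀ a, t ≤ a → a + 2 ≤ r → f a ≤ f (a + 1) → f (a + 1) ≤ f (a + 2) :=
    fun a h1 h2 h3 => (hf a h1 h2 h3).le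
  obtain ⟨c, rfl⟩ : ∃ d, c = d + 1 := ⟨c - 1, by omega⟩
  rcases le_or_gt (f c) (f (c + 1)) with h | h
  · have h1 := hf c (by omega) (by omega) h
    refine Or.inr (h1.trans_le ?_)
    rcases Nat.lt_or_ge (c + 2) r with h' | h'
    · exact le_of_increase_persists hf' (by omega) (hf' (c + 1) (by omega) h' h1.le) h'.le le_rfl
    · rw [show c + 2 = r by omega]
  · exact (le_max_ends hf' (by omega) (by omega)).imp
      (fun h1 => h.trans_le h1) fun h1 => h.trans_le h1

/-- If increases persist strictly and the sequence starts with one, an earlier index ties with the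
right end only on an interval of length one. -/
theorem eq_of_eq_end {f : ℕ → ℕ} {t r c : ℕ} (hf : ∀ a, t ≤ a → a + 2 ≤ r →
    f a ≤ f (a + 1) → f (a + 1) < f (a + 2)) (h0 : f t ≤ f (t + 1)) (htc : t ≤ c) (hcr : c < r)
    (heq : f c = f r) : c = t ∧ r = t + 1 := by
  have hf' : ∀ a, t ≤ a → a + 2 ≤ r → f a ≤ f (a + 1) → f (a + 1) ≤ f (a + 2) :=
    fun a h1 h2 h3 => (hf a h1 h2 h3).le
  have step : ∀ b, t ≤ b → b + 1 ≤ r → f b ≤ f (b + 1) := fun b hb hbr =>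
    le_succ_of_increase_persists hf' le_rfl h0 hb hbr
  have hc := step c htc hcr
  by_cases h2 : c + 2 ≤ r
  · have h3 := hf c htc h2 hc
    rcases h2.eq_or_lt with h4 | h4
    · rw [← h4] at heq; omega
    · have h5 := le_of_increase_persists hf' (by omega) (step (c + 2) (by omega) h4) h2 le_rfl
      omega
  have hr : r = c + 1 := by omega
  subst hr
  rcases htc.eq_or_lt with rfl | htc'
  · exact ⟨rfl, rfl⟩
  · obtain ⟨d, rfl⟩ : ∃ d, c = d + 1 := ⟨c - 1, by omega⟩
    have := hf d (by omega) le_rfl (step d (by omega) (by omega))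
    exact absurd heq this.ne

/-- The number of sets in the pair consisting of all sets with size in `R` containing a given
`a`-set and all sets with size in `S` meeting that `a`-set in at least `t` elements. -/
def pairTotal (n t : ℕ) (R S : Finset ℕ) (a : ℕ) : ℕ :=
  extCount (n - a) R a + ∑ k ∈ Ico t (a + 1), a.choose k * extCount (n - a) S k

theorem sum_choose_mul_succ (f : ℕ → ℕ) {a t : ℕ} (ht : 0 < t) (hta : t ≤ a + 1) :
    ∑ k ∈ Ico t (a + 2), (a + 1).choose k * f k =
      ∑ k ∈ Ico t (a + 1), a.choose k * (f k + f (k + 1)) + a.choose (t - 1) * f t := by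
  obtain ⟨t, rfl⟩ : ∃ t', t = t' + 1 := ⟨t - 1, by omega⟩
  have h1 : ∑ k ∈ Ico (t + 1) (a + 2), (a + 1).choose k * f k =
      ∑ k ∈ Ico t (a + 1), (a.choose k * f (k + 1) + a.choose (k + 1) * f (k + 1)) := by
    rw [← sum_Ico_add' (fun k => (a + 1).choose k * f k) t (a + 1) 1]
    exact sum_congr rfl fun k _ => by rw [Nat.choose_succ_succ, add_mul]
  have h2 : ∑ k ∈ Ico t (a + 1), a.choose (k + 1) * f (k + 1) =
      ∑ k ∈ Ico (t + 1) (a + 1), a.choose k * f k := by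
    rw [sum_Ico_add' (fun k => a.choose k * f k) t (a + 1) 1, sum_Ico_succ_top (by omega),
      Nat.choose_succ_self, zero_mul, add_zero]
  rw [h1, sum_add_distrib, h2, sum_eq_sum_Ico_succ_bot (by omega)]
  simp only [mul_add, sum_add_distrib, Nat.add_sub_cancel]
  ring

theorem pairTotal_succ {n t a : ℕ} (R S : Finset ℕ) (ht : 0 < t) (hta : t ≤ a + 1) (ha : a < n) :
    pairTotal n t R S (a + 1) + extCount (n - (a + 1)) R a =
      pairTotal n t R S a + a.choose (t - 1) * extCount (n - (a + 1)) S t := by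
  obtain ⟨N, hN⟩ : ∃ N, N = n - (a + 1) := ⟨_, rfl⟩
  have hN' : n - a = N + 1 := by omega
  unfold pairTotal
  rw [sum_choose_mul_succ _ ht hta, ← hN, hN', extCount_succ N R a]
  simp only [extCount_succ N S]
  ring

theorem pairTotal_le_succ_iff {n t a : ℕ} (R S : Finset ℕ) (ht : 0 < t) (hta : t ≤ a + 1)
    (ha : a < n) : pairTotal n t R S a ≤ pairTotal n t R S (a + 1) ↔
      extCount (n - (a + 1)) R a ≤ a.choose (t - 1) * extCount (n - (a + 1)) S t := by
  have := pairTotal_succ R S ht hta ha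
  omega

theorem pairTotal_lt_succ_iff {n t a : ℕ} (R S : Finset ℕ) (ht : 0 < t) (hta : t ≤ a + 1)
    (ha : a < n) : pairTotal n t R S a < pairTotal n t R S (a + 1) ↔
      extCount (n - (a + 1)) R a < a.choose (t - 1) * extCount (n - (a + 1)) S t := by
  have := pairTotal_succ R S ht hta ha
  omega

theorem pairTotal_self_comm (n t : ℕ) (R S : Finset ℕ) :
    pairTotal n t R S t = pairTotal n t S R t := by
  unfold pairTotal
  simp [add_comm]

theorem pairTotal_increase_persists {n t r s a : ℕ} {R S : Finset ℕ} (ht : 0 < t)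
    (hr : IsGreatest (R : Set ℕ) r) (hs : IsGreatest (S : Set ℕ) s) (hts : t ≤ s)
    (hn : r + s + 1 ≤ n + t) (hta : t ≤ a) (har : a + 2 ≤ r)
    (h : pairTotal n t R S a ≤ pairTotal n t R S (a + 1)) :
    pairTotal n t R S (a + 1) ≤ pairTotal n t R S (a + 2) := by
  rw [pairTotal_le_succ_iff R S ht (by omega) (by omega)] at h ⊢
  obtain ⟨N, hN⟩ : ∃ N, N = n - (a + 1 + 1) := ⟨_, rfl⟩
  rw [show n - (a + 1) = N + 1 by omega, extCount_succ, extCount_succ] at h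
  rw [← hN]
  have hmul := extCount_mul_le (N := N) (u := a) (v := t) hr.2 hs.2 (by omega)
  have hy : 0 < extCount N S t := extCount_pos hs.1 hts (by omega)
  have hc : a.choose (t - 1) ≤ (a + 1).choose (t - 1) := Nat.choose_le_choose _ (Nat.le_succ a)
  by_contra! hlt
  have h1 : a.choose (t - 1) * extCount N S t < extCount N R (a + 1) :=
    (Nat.mul_le_mul_right _ hc).trans_lt hlt
  have h2 : a.choose (t - 1) * extCount N S (t + 1) ≤ extCount N R a := by
    refine Nat.le_of_mul_le_mul_right (c := extCount N S t) ?_ hy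
    calc a.choose (t - 1) * extCount N S (t + 1) * extCount N S t
        = (a.choose (t - 1) * extCount N S t) * extCount N S (t + 1) := by ring
      _ ≤ extCount N R (a + 1) * extCount N S (t + 1) := Nat.mul_le_mul_right _ h1.le
      _ ≤ _ := hmul
  rw [mul_add] at h
  omega

theorem pairTotal_increase_persists_strictly {n t r s a : ℕ} {R S : Finset ℕ} (ht : 0 < t)
    (hr : IsGreatest (R : Set ℕ) r) (hs : IsGreatest (S : Set ℕ) s) (hts : t ≤ s)
    (hn : r + s + 2 ≤ n + t) (hta : t ≤ a) (har : a + 2 ≤ r)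
    (h : pairTotal n t R S a ≤ pairTotal n t R S (a + 1)) :
    pairTotal n t R S (a + 1) < pairTotal n t R S (a + 2) := by
  rw [pairTotal_le_succ_iff R S ht (by omega) (by omega)] at h
  rw [pairTotal_lt_succ_iff R S ht (by omega) (by omega)]
  obtain ⟨N, hN⟩ : ∃ N, N = n - (a + 1 + 1) := ⟨_, rfl⟩
  rw [show n - (a + 1) = N + 1 by omega, extCount_succ, extCount_succ] at h
  rw [← hN]
  have hX : 0 < extCount N R a := extCount_pos hr.1 (by omega) (by omega)
  have hy : 0 < extCount N S t := extCount_pos hs.1 hts (by omega)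
  have hmul := extCount_mul_lt (N := N) (u := a) (v := t) hr.2 hs.2 (by omega) hX hy
  have hc : a.choose (t - 1) ≤ (a + 1).choose (t - 1) := Nat.choose_le_choose _ (Nat.le_succ a)
  by_contra! hlt
  have h1 : a.choose (t - 1) * extCount N S t ≤ extCount N R (a + 1) :=
    (Nat.mul_le_mul_right _ hc).trans hlt
  have h2 : a.choose (t - 1) * extCount N S (t + 1) < extCount N R a := by
    refine Nat.lt_of_mul_lt_mul_right (a := extCount N S t) ?_
    calc a.choose (t - 1) * extCount N S (t + 1) * extCount N S t
        = (a.choose (t - 1) * extCount N S t) * extCount N S (t + 1) := by ring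
      _ ≤ extCount N R (a + 1) * extCount N S (t + 1) := Nat.mul_le_mul_right _ h1
      _ < _ := hmul
  rw [mul_add] at h
  omega

theorem choose_self_sub_one {t : ℕ} (ht : 0 < t) : t.choose (t - 1) = t := by
  rw [Nat.choose_symm_of_eq_add (show t = t - 1 + 1 by omega), Nat.choose_one_right]

/-- The common value of the two kinds of pairs at `a = t` is at most one of the two extremes. -/
theorem pairTotal_self_le {n t r s : ℕ} {R S : Finset ℕ} (ht : 0 < t)
    (hr : IsGreatest (R : Set ℕ) r) (hs : IsGreatest (S : Set ℕ) s) (htr : t ≤ r) (hts : t ≤ s)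
    (hn : r + s + 1 ≤ n + t) :
    pairTotal n t R S t ≤ max (pairTotal n t R S r) (pairTotal n t S R s) := by
  rw [le_max_iff]
  rcases htr.eq_or_lt with rfl | htr'
  · exact Or.inl le_rfl
  rcases hts.eq_or_lt with rfl | hts'
  · exact Or.inr (pairTotal_self_comm n t R S).le
  have hle : ∀ x : ℕ, x ≤ t * x := fun x => Nat.le_mul_of_pos_left x ht
  rcases le_total (extCount (n - (t + 1)) R t) (extCount (n - (t + 1)) S t) with h | h
  · left
    refine le_of_increase_persists (fun a h1 h2 => pairTotal_increase_persists (a := a)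
      ht hr hs hts hn h1 h2) le_rfl ?_ htr le_rfl
    rw [pairTotal_le_succ_iff R S ht (by omega) (by omega), choose_self_sub_one ht]
    exact h.trans (hle _)
  · right
    rw [pairTotal_self_comm]
    refine le_of_increase_persists (fun a h1 h2 => pairTotal_increase_persists (a := a) ht hs hr htr
      (by omega) h1 h2) le_rfl ?_ hts le_rfl
    rw [pairTotal_le_succ_iff S R ht (by omega) (by omega), choose_self_sub_one ht]
    exact h.trans (hle _)

theorem pairTotal_le {n t r s a : ℕ} {R S : Finset ℕ} (ht : 0 < t)
    (hr : IsGreatest (R : Set ℕ) r) (hs : IsGreatest (S : Set ℕ) s) (hts : t ≤ s)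
    (hn : r + s + 1 ≤ n + t) (hta : t ≤ a) (har : a ≤ r) :
    pairTotal n t R S a ≤ max (pairTotal n t R S r) (pairTotal n t S R s) := by
  rcases le_max_ends (fun a h1 h2 => pairTotal_increase_persists (a := a)
    ht hr hs hts hn h1 h2) hta har with h | h
  · exact h.trans (pairTotal_self_le ht hr hs (hta.trans har) hts hn)
  · exact h.trans (le_max_left _ _)

theorem pairTotal_eq_starBound {n t r : ℕ} {R : Finset ℕ} (S : Finset ℕ)
    (hr : IsGreatest (R : Set ℕ) r) : pairTotal n t R S r = starBound n t r S := by
  unfold pairTotal starBound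
  rw [extCount_self hr]
  congr 1
  unfold extCount
  simp only [mul_sum]
  rw [sum_comm]
  refine sum_congr rfl fun i _ => ?_
  rw [← sum_filter_add_sum_filter_not (Icc t i) (fun k => k ≤ r),
    sum_eq_zero (s := (Icc t i).filter fun k => ¬ k ≤ r) (fun k hk => by
      rw [Nat.choose_eq_zero_of_lt (not_le.1 (mem_filter.1 hk).2), zero_mul]), add_zero]
  simp only [mul_ite, mul_zero]
  rw [← sum_filter]
  refine sum_congr ?_ fun _ _ => rfl
  ext k
  simp only [mem_filter, mem_Ico, mem_Icc]
  omega

/-! ### The weighted bound and shifted extremal families -/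

theorem weight_filter_le_card (w : ℕ → ℕ) (a t : ℕ) :
    weight w ((range a).powerset.filter fun V => t ≤ V.card) =
      ∑ k ∈ Ico t (a + 1), a.choose k * w k := by
  unfold weight
  rw [sum_filter, sum_powerset_apply_card (f := fun k => if t ≤ k then w k else 0)
    (x := range a), card_range]
  simp only [smul_eq_mul, mul_ite, mul_zero]
  rw [← sum_filter]
  refine sum_congr ?_ fun _ _ => rfl
  ext k
  simp only [mem_filter, mem_range, mem_Ico]
  omega

theorem forall_card_of_weight_eq {𝒜 𝒜' : Finset (Finset ℕ)}
    (h : ∀ w, weight w 𝒜' = weight w 𝒜) {p : ℕ → Prop} (hp : ∀ A ∈ 𝒜, p A.card) :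
    ∀ A ∈ 𝒜', p A.card := by
  classical
  intro A hA
  by_contra hn
  have h1 := h fun k => if p k then 0 else 1
  have h2 : weight (fun k => if p k then 0 else 1) 𝒜 = 0 :=
    sum_eq_zero fun B hB => if_pos (hp B hB)
  rw [h2] at h1
  have := (sum_eq_zero_iff.1 h1) A hA
  simp [hn] at this

theorem card_eq_of_weight_eq {𝒜 𝒜' : Finset (Finset ℕ)}
    (h : ∀ w, weight w 𝒜' = weight w 𝒜) : 𝒜'.card = 𝒜.card := by
  simpa [weight] using h fun _ => 1

theorem Cross.le_card_of_range {t a : ℕ} {ℬ : Finset (Finset ℕ)} (h : Cross t {range a} ℬ)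
    (hB : ∀ B ∈ ℬ, B ⊆ range a) {B : Finset ℕ} (hBm : B ∈ ℬ) : t ≤ B.card := by
  have := h _ (mem_singleton_self _) B hBm
  rwa [inter_eq_right.2 (hB B hBm)] at this

theorem weight_le_pairTotal_of_range {N a t r : ℕ} {R S : Finset ℕ}
    (hr : IsGreatest (R : Set ℕ) r) {ℬ : Finset (Finset ℕ)} (hB : ∀ B ∈ ℬ, B ⊆ range a)
    (h : Cross t {range a} ℬ) (hpos : 0 < extCount N R (range a).card) (hne : ℬ.Nonempty) :
    t ≤ a ∧ a ≤ r ∧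
      weight (extCount N R) {range a} + weight (extCount N S) ℬ ≤ pairTotal (N + a) t R S a := by
  rw [card_range] at hpos
  obtain ⟨B, hBm⟩ := hne
  refine ⟨?_, ?_, ?_⟩
  · have := card_le_card (hB B hBm)
    rw [card_range] at this
    exact (h.le_card_of_range hB hBm).trans this
  · obtain ⟨i, hi, hai, -⟩ := exists_of_extCount_pos hpos
    exact hai.trans (hr.2 hi)
  · unfold pairTotal
    rw [Nat.add_sub_cancel, ← weight_filter_le_card]
    refine Nat.add_le_add (by simp [weight]) (weight_mono _ fun V hV => ?_)
    exact mem_filter.2 ⟨mem_powerset.2 (hB V hV), h.le_card_of_range hB hV⟩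

/-- The weighted form of the upper bound, on `a` of the `N + a` points. -/
theorem weight_add_weight_le {n t r s : ℕ} {R S : Finset ℕ} (ht : 0 < t)
    (hr : IsGreatest (R : Set ℕ) r) (hs : IsGreatest (S : Set ℕ) s) (htr : t ≤ r) (hts : t ≤ s)
    (hn : r + s + 1 ≤ n + t) {a N : ℕ} (haN : N + a = n) {𝒜 ℬ : Finset (Finset ℕ)}
    (hA : ∀ A ∈ 𝒜, A ⊆ range a) (hB : ∀ B ∈ ℬ, B ⊆ range a) (h : Cross t 𝒜 ℬ)
    (hposA : ∀ A ∈ 𝒜, 0 < extCount N R A.card) (hposB : ∀ B ∈ ℬ, 0 < extCount N S B.card)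
    (hneA : 𝒜.Nonempty) (hneB : ℬ.Nonempty) :
    weight (extCount N R) 𝒜 + weight (extCount N S) ℬ ≤
      max (pairTotal n t R S r) (pairTotal n t S R s) := by
  induction a generalizing N 𝒜 ℬ with
  | zero =>
    obtain ⟨A, hAm⟩ := hneA
    obtain ⟨B, hBm⟩ := hneB
    have h1 := h A hAm B hBm
    have h2 := card_le_card (inter_subset_left.trans (hA A hAm) : A ∩ B ⊆ range 0)
    simp at h2
    simp [h2] at h1
    omega
  | succ a ih =>
    obtain ⟨𝒜', ℬ', hA', hB', h', hshA, hshB, hwA, hwB⟩ := exists_shifted 𝒜 ℬ hA hB h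
    rw [← hwA, ← hwB]
    have hposA' := forall_card_of_weight_eq hwA (p := fun k => 0 < extCount N R k) hposA
    have hposB' := forall_card_of_weight_eq hwB (p := fun k => 0 < extCount N S k) hposB
    have hneA' : 𝒜'.Nonempty := card_pos.1 (card_eq_of_weight_eq hwA ▸ card_pos.2 hneA)
    have hneB' : ℬ'.Nonempty := card_pos.1 (card_eq_of_weight_eq hwB ▸ card_pos.2 hneB)
    by_cases hA1 : 𝒜' = {range (a + 1)}
    · subst hA1
      obtain ⟨h1, h2, h3⟩ := weight_le_pairTotal_of_range (S := S) hr hB' h'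
        (hposA' _ (mem_singleton_self _)) hneB'
      rw [haN] at h3
      exact h3.trans (pairTotal_le ht hr hs hts hn h1 h2)
    by_cases hB1 : ℬ' = {range (a + 1)}
    · subst hB1
      obtain ⟨h1, h2, h3⟩ := weight_le_pairTotal_of_range (S := R) hs hA' h'.symm
        (hposB' _ (mem_singleton_self _)) hneA'
      rw [haN] at h3
      rw [add_comm, max_comm]
      exact h3.trans (pairTotal_le ht hs hr htr (by omega) h1 h2)
    obtain ⟨𝒜₁, ℬ₁, k1, k2, k3, k4, k5, k6, k7, k8, -⟩ := exists_projection (N := N) hr.2 hs.2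
      (by omega) hA' hB' h' hshA hshB hposA' hposB' hneA' hneB' hA1 hB1
    exact k8.trans (ih (by omega) k1 k2 k3 k6 k7 k4 k5)

theorem eq_filter_of_image_erase_eq {N a : ℕ} {M : Finset ℕ} {p : Finset ℕ → Prop}
    [DecidablePred p] (hp : ∀ U, p (U.erase a) ↔ p U) {𝒜 : Finset (Finset ℕ)}
    (hA : ∀ A ∈ 𝒜, A ⊆ range (a + 1)) (hpos : ∀ A ∈ 𝒜, 0 < extCount N M A.card)
    (him : (𝒜.image fun U => U.erase a) =
      (range a).powerset.filter fun W => p W ∧ 0 < extCount (N + 1) M W.card)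
    (hw : weight (extCount (N + 1) M) (𝒜.image fun U => U.erase a) ≤ weight (extCount N M) 𝒜) :
    𝒜 = (range (a + 1)).powerset.filter fun U => p U ∧ 0 < extCount N M U.card := by
  refine eq_of_subset_of_weight_le (w := extCount N M) ?_ (fun B hB => (mem_filter.1 hB).2.2) ?_
  · intro U hU
    have : U.erase a ∈ 𝒜.image fun U => U.erase a := mem_image_of_mem _ hU
    rw [him, mem_filter, hp] at this
    exact mem_filter.2 ⟨mem_powerset.2 (hA U hU), this.2.1, hpos U hU⟩
  · refine le_trans ?_ hw
    have h1 := weight_add_le_weight_image_erase (extCount N M) a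
      (𝒦 := (range (a + 1)).powerset.filter fun U => p U ∧ 0 < extCount N M U.card) (ℰ := ∅)
      (empty_subset _) (by simp) (by simp)
    rw [sum_empty, add_zero,
      show (fun k => extCount N M k + extCount N M (k + 1)) = extCount (N + 1) M from
        funext fun k => (extCount_succ N M k).symm] at h1
    refine h1.trans (weight_mono _ ?_)
    rw [him]
    intro W hW
    obtain ⟨U, hU, rfl⟩ := mem_image.1 hW
    obtain ⟨hU1, hU2, hU3⟩ := mem_filter.1 hU
    refine mem_filter.2 ⟨mem_powerset.2 fun x hx => ?_, (hp U).2 hU2, ?_⟩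
    · have h1 := mem_range.1 (mem_powerset.1 hU1 (mem_of_mem_erase hx))
      have h2 := ne_of_mem_erase hx
      exact mem_range.2 (by omega)
    · rw [extCount_succ]
      by_cases ha : a ∈ U
      · rw [card_erase_add_one ha]; omega
      · rw [erase_eq_of_notMem ha]; omega

/-- On the first `a` of `N + a` points: `𝒜` consists of the sets containing `range c` and `ℬ` of
those meeting `range c` in at least `t` elements, in both cases restricted to sets that can be
enlarged to a size in `R` or `S`, respectively, outside the first `a` points. -/
def IsCanonicalPair (N a t c : ℕ) (R S : Finset ℕ) (𝒜 ℬ : Finset (Finset ℕ)) : Prop :=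
  𝒜 = ((range a).powerset.filter fun U => range c ⊆ U ∧ 0 < extCount N R U.card) ∧
  ℬ = (range a).powerset.filter fun V => t ≤ (V ∩ range c).card ∧ 0 < extCount N S V.card

theorem isCanonicalPair_of_range {N a t : ℕ} {R S : Finset ℕ} {ℬ : Finset (Finset ℕ)}
    (hB : ∀ B ∈ ℬ, B ⊆ range a) (h : Cross t {range a} ℬ)
    (hposR : 0 < extCount N R (range a).card) (hposB : ∀ B ∈ ℬ, 0 < extCount N S B.card)
    (hle : pairTotal (N + a) t R S a ≤
      weight (extCount N R) {range a} + weight (extCount N S) ℬ) :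
    IsCanonicalPair N a t a R S {range a} ℬ := by
  constructor
  · ext U
    rw [mem_singleton, mem_filter, mem_powerset]
    constructor
    · rintro rfl; exact ⟨Subset.rfl, Subset.rfl, hposR⟩
    · rintro ⟨h1, h2, -⟩; exact h1.antisymm h2
  · refine eq_of_subset_of_weight_le (w := extCount N S) (fun V hV => ?_)
      (fun B hB => (mem_filter.1 hB).2.2) ?_
    · refine mem_filter.2 ⟨mem_powerset.2 (hB V hV), ?_, hposB V hV⟩
      rw [inter_comm]
      exact h _ (mem_singleton_self _) V hV
    · have h1 : weight (extCount N R) {range a} = extCount N R a := by simp [weight]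
      unfold pairTotal at hle
      rw [Nat.add_sub_cancel, ← weight_filter_le_card, h1] at hle
      refine le_trans (weight_mono _ fun V hV => ?_) (Nat.le_of_add_le_add_left hle)
      obtain ⟨h1, h2, -⟩ := mem_filter.1 hV
      exact mem_filter.2 ⟨h1, h2.trans (card_le_card inter_subset_left)⟩

theorem IsCanonicalPair.of_image_erase {N a t c : ℕ} {R S : Finset ℕ}
    {𝒜 ℬ : Finset (Finset ℕ)} (hA : ∀ A ∈ 𝒜, A ⊆ range (a + 1))
    (hB : ∀ B ∈ ℬ, B ⊆ range (a + 1)) (hposA : ∀ A ∈ 𝒜, 0 < extCount N R A.card)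
    (hposB : ∀ B ∈ ℬ, 0 < extCount N S B.card) (hca : c ≤ a)
    (h : IsCanonicalPair (N + 1) a t c R S (𝒜.image fun U => U.erase a)
      (ℬ.image fun U => U.erase a))
    (hwA : weight (extCount (N + 1) R) (𝒜.image fun U => U.erase a) ≤ weight (extCount N R) 𝒜)
    (hwB : weight (extCount (N + 1) S) (ℬ.image fun U => U.erase a) ≤ weight (extCount N S) ℬ) :
    IsCanonicalPair N (a + 1) t c R S 𝒜 ℬ := by
  have hac : a ∉ range c := by simp [hca]
  constructor
  · refine eq_filter_of_image_erase_eq (p := fun U => range c ⊆ U) (fun U => ?_) hA hposA h.1 hwA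
    exact ⟨fun hh => hh.trans (erase_subset _ _), fun hh => subset_erase.2 ⟨hh, hac⟩⟩
  · refine eq_filter_of_image_erase_eq (p := fun V => t ≤ (V ∩ range c).card) (fun U => ?_)
      hB hposB h.2 hwB
    rw [erase_inter, erase_eq_of_notMem fun hh => hac (mem_inter.1 hh).2]

theorem IsShifted.image_erase {a : ℕ} {𝒜 : Finset (Finset ℕ)} (h : IsShifted (a + 1) 𝒜) :
    IsShifted a (𝒜.image fun U => U.erase a) := by
  intro W hW i j hij hja hj hi
  obtain ⟨U, hU, rfl⟩ := mem_image.1 hW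
  have hia : i ≠ a := by omega
  have hm := h U hU i j hij (by omega) (mem_of_mem_erase hj) fun hh => hi (mem_erase.2 ⟨hia, hh⟩)
  refine mem_image.2 ⟨_, hm, ?_⟩
  rw [erase_insert_of_ne hia, erase_right_comm]

/-- Shifted families attaining the bound are canonical, if `n` is not extremal. -/
theorem exists_isCanonicalPair {n t r s : ℕ} {R S : Finset ℕ} (ht : 0 < t)
    (hr : IsGreatest (R : Set ℕ) r) (hs : IsGreatest (S : Set ℕ) s) (htr : t ≤ r) (hts : t ≤ s)
    (hn : r + s + 2 ≤ n + t) {a N : ℕ} (haN : N + a = n) {𝒜 ℬ : Finset (Finset ℕ)}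
    (hA : ∀ A ∈ 𝒜, A ⊆ range a) (hB : ∀ B ∈ ℬ, B ⊆ range a) (h : Cross t 𝒜 ℬ)
    (hshA : IsShifted a 𝒜) (hshB : IsShifted a ℬ)
    (hposA : ∀ A ∈ 𝒜, 0 < extCount N R A.card) (hposB : ∀ B ∈ ℬ, 0 < extCount N S B.card)
    (hneA : 𝒜.Nonempty) (hneB : ℬ.Nonempty)
    (heq : weight (extCount N R) 𝒜 + weight (extCount N S) ℬ =
      max (pairTotal n t R S r) (pairTotal n t S R s)) :
    ∃ c, t ≤ c ∧ c ≤ a ∧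
      ((c ≤ r ∧ pairTotal n t R S c = max (pairTotal n t R S r) (pairTotal n t S R s) ∧
        IsCanonicalPair N a t c R S 𝒜 ℬ) ∨
      (c ≤ s ∧ pairTotal n t S R c = max (pairTotal n t R S r) (pairTotal n t S R s) ∧
        IsCanonicalPair N a t c S R ℬ 𝒜)) := by
  induction a generalizing N 𝒜 ℬ with
  | zero =>
    obtain ⟨A, hAm⟩ := hneA
    obtain ⟨B, hBm⟩ := hneB
    have h1 := h A hAm B hBm
    have h2 := card_le_card (inter_subset_left.trans (hA A hAm) : A ∩ B ⊆ range 0)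
    simp at h2
    simp [h2] at h1
    omega
  | succ a ih =>
    by_cases hA1 : 𝒜 = {range (a + 1)}
    · subst hA1
      have hpos := hposA _ (mem_singleton_self _)
      obtain ⟨h1, h2, h3⟩ := weight_le_pairTotal_of_range (S := S) hr hB h hpos hneB
      have h4 := pairTotal_le (n := n) ht hr hs hts (by omega) h1 h2
      have h5 := isCanonicalPair_of_range hB h hpos hposB (by rw [haN, heq]; exact h4)
      rw [haN] at h3
      exact ⟨a + 1, h1, le_rfl, Or.inl ⟨h2, le_antisymm h4 (heq ▸ h3), h5⟩⟩
    by_cases hB1 : ℬ = {range (a + 1)}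
    · subst hB1
      have hpos := hposB _ (mem_singleton_self _)
      obtain ⟨h1, h2, h3⟩ := weight_le_pairTotal_of_range (S := R) hs hA h.symm hpos hneA
      have h4 := pairTotal_le (n := n) ht hs hr htr (by omega) h1 h2
      rw [max_comm] at h4
      rw [add_comm] at heq
      have h5 := isCanonicalPair_of_range hA h.symm hpos hposA (by rw [haN, heq]; exact h4)
      rw [haN] at h3
      exact ⟨a + 1, h1, le_rfl, Or.inr ⟨h2, le_antisymm h4 (heq ▸ h3), h5⟩⟩
    obtain ⟨𝒜₁, ℬ₁, k1, k2, k3, k4, k5, k6, k7, k8, k9⟩ := exists_projection (N := N) hr.2 hs.2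
      (by omega) hA hB h hshA hshB hposA hposB hneA hneB hA1 hB1
    have hle := weight_add_weight_le (n := n) ht hr hs htr hts (by omega) (by omega) k1 k2 k3
      k6 k7 k4 k5
    -- a strict gain would contradict the weighted bound on `a` points
    rcases k9 (by omega) with hlt | ⟨rfl, rfl⟩
    · omega
    have gA := weight_add_le_weight_image_erase (extCount N R) a (𝒦 := 𝒜) (ℰ := ∅)
      (empty_subset _) (by simp) (by simp)
    have gB := weight_add_le_weight_image_erase (extCount N S) a (𝒦 := ℬ) (ℰ := ∅)
      (empty_subset _) (by simp) (by simp)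
    have e : ∀ M, (fun k => extCount N M k + extCount N M (k + 1)) = extCount (N + 1) M :=
      fun M => funext fun k => (extCount_succ N M k).symm
    rw [sum_empty, add_zero, e] at gA gB
    obtain ⟨c, htc, hca, hc⟩ := ih (by omega) k1 k2 k3 hshA.image_erase hshB.image_erase k6 k7 k4 k5
      (by omega)
    refine ⟨c, htc, by omega, hc.imp (fun hh => ⟨hh.1, hh.2.1, ?_⟩) fun hh => ⟨hh.1, hh.2.1, ?_⟩⟩
    · exact hh.2.2.of_image_erase hA hB hposA hposB hca (by omega) (by omega)
    · exact hh.2.2.of_image_erase hB hA hposB hposA hca (by omega) (by omega)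

/-! ### Uniqueness of the best candidate -/

theorem eq_of_pairTotal_eq_of_same {n t r c : ℕ} {R : Finset ℕ} (ht : 0 < t)
    (hr : IsGreatest (R : Set ℕ) r) (hn : r + r + 2 ≤ n + t) (htc : t ≤ c) (hcr : c ≤ r)
    (heq : pairTotal n t R R c = pairTotal n t R R r) : c = r ∨ (t = 1 ∧ c = 1 ∧ r = 2) := by
  rcases hcr.eq_or_lt with h | hcr'
  · exact Or.inl h
  right
  have h0 : pairTotal n t R R t ≤ pairTotal n t R R (t + 1) := by
    rw [pairTotal_le_succ_iff R R ht (by omega) (by omega), choose_self_sub_one ht]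
    exact Nat.le_mul_of_pos_left _ ht
  obtain ⟨h1, h2⟩ := eq_of_eq_end (fun a h1 h2 => pairTotal_increase_persists_strictly (a := a)
    ht hr hr (by omega) hn h1 h2) h0 htc hcr' heq
  rw [h1, h2] at heq
  have h3 := pairTotal_succ R R ht (show t ≤ t + 1 by omega) (show t < n by omega)
  rw [choose_self_sub_one ht, heq] at h3
  have hpos : 0 < extCount (n - (t + 1)) R t := extCount_pos hr.1 (by omega) (by omega)
  have h4 : 1 * extCount (n - (t + 1)) R t = t * extCount (n - (t + 1)) R t := by omega
  have := Nat.eq_of_mul_eq_mul_right hpos h4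
  omega

/-- Well below the middle, a binomial coefficient exceeds any earlier one by a large factor. -/
theorem mul_choose_lt_choose {N K j k : ℕ} (hK : 1 ≤ K) (hjk : j < k) (hN : K * k + k ≤ N) :
    K * N.choose j < N.choose k := by
  induction k, Nat.succ_le_of_lt hjk using Nat.le_induction with
  | base =>
    have h1 := Nat.choose_succ_right_eq N j
    have h2 : 0 < N.choose j := Nat.choose_pos (by
      have := Nat.zero_le (K * (j + 1)); simp only [Nat.succ_eq_add_one] at hN; omega)
    refine Nat.lt_of_mul_lt_mul_right (a := j + 1) ?_
    rw [Nat.succ_eq_add_one] at hN ⊢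
    rw [h1, show K * N.choose j * (j + 1) = N.choose j * (K * (j + 1)) by ring]
    exact Nat.mul_lt_mul_of_pos_left (by omega) h2
  | succ k hk ih =>
    have hN' : K * (k + 1) = K * k + K := by ring
    have h3 := ih (by omega) (by omega)
    refine h3.trans ?_
    have h1 := Nat.choose_succ_right_eq N k
    have h2 : 0 < N.choose k := by omega
    have h4 : k + 1 ≤ K * (k + 1) := Nat.le_mul_of_pos_left _ hK
    refine Nat.lt_of_mul_lt_mul_right (a := k + 1) ?_
    rw [h1]
    exact Nat.mul_lt_mul_of_pos_left (by omega) h2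

theorem choose_mono_of_two_mul_le {N j k : ℕ} (hjk : j ≤ k) (hN : 2 * k ≤ N) :
    N.choose j ≤ N.choose k := by
  rcases hjk.eq_or_lt with rfl | h
  · exact le_rfl
  · have := mul_choose_lt_choose (N := N) (K := 1) le_rfl h (by omega)
    omega

theorem sum_lt_of_forall_mul_lt {T : Finset ℕ} {g : ℕ → ℕ} {K b : ℕ} (hT : T.card ≤ K)
    (hb : 0 < b) (h : ∀ i ∈ T, K * g i < b) : ∑ i ∈ T, g i < b := by
  rcases T.eq_empty_or_nonempty with rfl | hne
  · simpa using hb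
  · have h1 : K * ∑ i ∈ T, g i < T.card * b := by
      rw [mul_sum, ← smul_eq_mul T.card, ← sum_const]
      exact sum_lt_sum_of_nonempty hne h
    exact Nat.lt_of_mul_lt_mul_left (h1.trans_le (Nat.mul_le_mul_right _ hT))

/-- Sums over `R` and `S` are compared by their largest differing index `m`, if the function grows
fast enough there. -/
theorem sum_lt_sum_of_isGreatest_symmDiff {R S : Finset ℕ} {m : ℕ} (g : ℕ → ℕ)
    (hm : IsGreatest ((symmDiff R S : Finset ℕ) : Set ℕ) m) (hmS : m ∈ S) (hpos : 0 < g m)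
    (h : ∀ i ∈ R, i < m → R.card * g i < g m) : ∑ i ∈ R, g i < ∑ i ∈ S, g i := by
  have hmR : m ∉ R := by
    have := mem_symmDiff.1 (mem_coe.1 hm.1); tauto
  have h1 : ∑ i ∈ R with i < m, g i < g m :=
    sum_lt_of_forall_mul_lt (card_le_card (filter_subset _ _)) hpos fun i hi =>
      h i (mem_filter.1 hi).1 (mem_filter.1 hi).2
  rw [← sum_filter_add_sum_filter_not R (fun i => i < m)]
  have hd : m ∉ R.filter fun i => ¬ i < m := fun hh => hmR (mem_filter.1 hh).1
  calc ∑ i ∈ R with i < m, g i + ∑ i ∈ R with ¬ i < m, g i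
      < g m + ∑ i ∈ R with ¬ i < m, g i := Nat.add_lt_add_right h1 _
    _ = ∑ i ∈ insert m (R.filter fun i => ¬ i < m), g i := (sum_insert hd).symm
    _ ≤ ∑ i ∈ S, g i := by
      refine sum_le_sum_of_subset fun i hi => ?_
      rcases mem_insert.1 hi with rfl | hi
      · exact hmS
      · obtain ⟨hiR, hi⟩ := mem_filter.1 hi
        by_contra hiS
        have : i ≤ m := hm.2 (mem_coe.2 (mem_symmDiff.2 (Or.inl ⟨hiR, hiS⟩)))
        have : i = m := by omega
        exact hmR (this ▸ hiR)

/-- The number of `i`-subsets of an `n`-set meeting a given `a`-set in at least `t` elements. -/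
def meetCount (n t a i : ℕ) : ℕ := ∑ j ∈ Icc t i, a.choose j * (n - a).choose (i - j)

theorem choose_le_meetCount {n t a i : ℕ} (hta : t ≤ a) (hti : t ≤ i) :
    (n - a).choose (i - t) ≤ meetCount n t a i := by
  refine le_trans ?_ (single_le_sum (f := fun j => a.choose j * (n - a).choose (i - j))
    (fun _ _ => Nat.zero_le _) (mem_Icc.2 ⟨le_rfl, hti⟩))
  exact Nat.le_mul_of_pos_left _ (Nat.choose_pos hta)

theorem meetCount_le {n t a i : ℕ} (h : 2 * (i - t) ≤ n - a) :
    meetCount n t a i ≤ 2 ^ a * (n - a).choose (i - t) := by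
  have h1 : ∑ j ∈ Icc t i, a.choose j ≤ 2 ^ a := by
    rw [← Nat.sum_range_choose a, ← sum_filter_add_sum_filter_not (Icc t i) (fun j => j ≤ a),
      sum_eq_zero (s := (Icc t i).filter fun j => ¬ j ≤ a) (fun j hj =>
        Nat.choose_eq_zero_of_lt (not_le.1 (mem_filter.1 hj).2)), add_zero]
    refine sum_le_sum_of_subset fun j hj => ?_
    have := (mem_filter.1 hj).2
    exact mem_range.2 (by omega)
  refine le_trans (sum_le_sum (g := fun j => a.choose j * (n - a).choose (i - t)) fun j hj => ?_) ?_
  · have := mem_Icc.1 hj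
    exact Nat.mul_le_mul_left _ (choose_mono_of_two_mul_le (by omega) h)
  · rw [← sum_mul]
    exact Nat.mul_le_mul_right _ h1

section LargeGroundSet

variable {n t r s m : ℕ} {R S : Finset ℕ}

theorem starBound_lt_starBound (htR : ∀ i ∈ R, t ≤ i) (htS : ∀ i ∈ S, t ≤ i)
    (hr : IsGreatest (R : Set ℕ) r) (hs : IsGreatest (S : Set ℕ) s)
    (hm : IsGreatest ((symmDiff R S : Finset ℕ) : Set ℕ) m) (hmS : m ∈ S)
    (h1 : 2 ^ (s + 1) * R.card * (s - t) + 2 * r + 1 ≤ n)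
    (h2 : 2 ^ (r + 1) * S.card * (r - t) + 2 * s + 1 ≤ n) :
    starBound n t s R < starBound n t r S := by
  have hRc : 1 ≤ R.card := card_pos.2 ⟨r, hr.1⟩
  have hSc : 1 ≤ S.card := card_pos.2 ⟨s, hs.1⟩
  have htr := htR r hr.1
  have hts := htS s hs.1
  have hms : m ≤ s := hs.2 hmS
  have htm := htS m hmS
  have hK : 1 ≤ R.card * 2 ^ s := Nat.mul_pos hRc (by positivity)
  have e1 : 2 ^ (s + 1) * R.card * (s - t) = 2 * (R.card * 2 ^ s * (s - t)) := by ring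
  have e2 : s - t ≤ R.card * 2 ^ s * (s - t) := Nat.le_mul_of_pos_left _ hK
  have e3 : R.card * 2 ^ s * (m - t) ≤ R.card * 2 ^ s * (s - t) :=
    Nat.mul_le_mul_left _ (by omega)
  have e4 : r - t ≤ 2 ^ (r + 1) * S.card * (r - t) :=
    Nat.le_mul_of_pos_left _ (Nat.mul_pos (by positivity) hSc)
  have e5 : 2 ^ (r + 1) * S.card * (r - t) = 2 * (2 ^ r * S.card * (r - t)) := by ring
  have e6 : r - t ≤ 2 ^ r * S.card * (r - t) :=
    Nat.le_mul_of_pos_left _ (Nat.mul_pos (by positivity) hSc)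
  suffices hsum : ∑ i ∈ R, meetCount n t s i < ∑ i ∈ S, meetCount n t r i from
    Nat.add_lt_add_left hsum 1
  -- the largest differing size lies in `S`, so `r ≤ s`, with `m = s` unless `r = s`
  have hcases : r = s ∨ (r < s ∧ m = s) := by
    rcases lt_trichotomy r s with h | h | h
    · refine Or.inr ⟨h, le_antisymm hms (hm.2 (mem_coe.2 (mem_symmDiff.2 (Or.inr ⟨hs.1, ?_⟩))))⟩
      exact fun hh => absurd (hr.2 hh) (not_le.2 h)
    · exact Or.inl h
    · have : r ≤ m := hm.2 (mem_coe.2 (mem_symmDiff.2 (Or.inl ⟨hr.1,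
        fun hh => absurd (hs.2 hh) (not_le.2 h)⟩)))
      omega
  have hlow := choose_le_meetCount (n := n) htr htm
  have hpos : 0 < meetCount n t r m := (Nat.choose_pos (by omega)).trans_le hlow
  rcases hcases with rfl | ⟨hrs, rfl⟩
  · refine sum_lt_sum_of_isGreatest_symmDiff _ hm hmS hpos fun i hi him => ?_
    have hti := htR i hi
    refine lt_of_le_of_lt ?_ ((mul_choose_lt_choose hK (show i - t < m - t by omega)
      (by omega)).trans_le hlow)
    rw [mul_assoc]
    exact Nat.mul_le_mul_left _ (meetCount_le (by omega))
  · refine (sum_lt_of_forall_mul_lt le_rfl hpos fun i hi => ?_).trans_le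
      (single_le_sum (f := fun i => meetCount n t r i) (fun _ _ => Nat.zero_le _) hmS)
    have hti := htR i hi
    have hir : i ≤ r := hr.2 hi
    refine lt_of_le_of_lt ?_ ((mul_choose_lt_choose hK (show i - t < m - t by omega)
      (by omega)).trans_le hlow)
    rw [mul_assoc]
    refine Nat.mul_le_mul_left _ ((meetCount_le (by omega)).trans (Nat.mul_le_mul_left _ ?_))
    exact Nat.choose_le_choose _ (by omega)

theorem pairTotal_self_lt_succ (ht : 0 < t) (htR : ∀ i ∈ R, t ≤ i) (htS : ∀ i ∈ S, t ≤ i)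
    (hs : IsGreatest (S : Set ℕ) s)
    (hm : IsGreatest ((symmDiff R S : Finset ℕ) : Set ℕ) m) (hmS : m ∈ S)
    (h1 : 2 ^ (s + 1) * R.card * (s - t) + 1 ≤ n) (h2 : 2 * s + 1 ≤ n) :
    pairTotal n t R S t < pairTotal n t R S (t + 1) := by
  have hms : m ≤ s := hs.2 hmS
  have htm := htS m hmS
  rw [pairTotal_lt_succ_iff R S ht (by omega) (by omega), choose_self_sub_one ht]
  refine lt_of_lt_of_le ?_ (Nat.le_mul_of_pos_left _ ht)
  refine sum_lt_sum_of_isGreatest_symmDiff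
    (fun i => if t ≤ i then (n - (t + 1)).choose (i - t) else 0) hm hmS ?_ fun i hi him => ?_
  · simp only [htm, if_true]
    exact Nat.choose_pos (by omega)
  · have hti := htR i hi
    simp only [htm, hti, if_true]
    have hRc : 1 ≤ R.card := card_pos.2 ⟨i, hi⟩
    have e1 : 2 ^ (s + 1) * R.card * (s - t) = 2 * (2 ^ s * (R.card * (s - t))) := by ring
    have e2 : R.card * (s - t) ≤ 2 ^ s * (R.card * (s - t)) :=
      Nat.le_mul_of_pos_left _ (by positivity)
    have e3 : R.card * (m - t) ≤ R.card * (s - t) := Nat.mul_le_mul_left _ (by omega)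
    exact mul_choose_lt_choose hRc (by omega) (by omega)

theorem eq_of_pairTotal_eq_left (ht : 0 < t) (htR : ∀ i ∈ R, t ≤ i) (htS : ∀ i ∈ S, t ≤ i)
    (hr : IsGreatest (R : Set ℕ) r) (hs : IsGreatest (S : Set ℕ) s)
    (hm : IsGreatest ((symmDiff R S : Finset ℕ) : Set ℕ) m) (hmS : m ∈ S)
    (h1 : 2 ^ (s + 1) * R.card * (s - t) + 2 * r + 1 ≤ n) (h2 : 2 * s + 1 ≤ n)
    {c : ℕ} (htc : t ≤ c) (hcr : c ≤ r) (heq : pairTotal n t R S c = pairTotal n t R S r) :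
    c = r := by
  by_contra hne
  have hlt := pairTotal_self_lt_succ ht htR htS hs hm hmS (by omega) h2
  obtain ⟨h3, h4⟩ := eq_of_eq_end (fun a h1 h2 => pairTotal_increase_persists_strictly (a := a)
    ht hr hs (htS s hs.1) (by omega) h1 h2) hlt.le htc (by omega) heq
  rw [h3, h4] at heq
  omega

/-- A pair with the single set in the second family attains the maximum only for `R = {t}`, where it
is also a pair with the single set in the first family. -/
theorem eq_of_pairTotal_eq_right (ht : 0 < t) (htR : ∀ i ∈ R, t ≤ i) (htS : ∀ i ∈ S, t ≤ i)
    (hr : IsGreatest (R : Set ℕ) r) (hs : IsGreatest (S : Set ℕ) s)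
    (hm : IsGreatest ((symmDiff R S : Finset ℕ) : Set ℕ) m) (hmS : m ∈ S)
    (h1 : 2 ^ (s + 1) * R.card * (s - t) + 2 * r + 1 ≤ n)
    (h2 : 2 ^ (r + 1) * S.card * (r - t) + 2 * s + 1 ≤ n)
    {c : ℕ} (htc : t ≤ c) (hcs : c ≤ s) (heq : pairTotal n t S R c = pairTotal n t R S r) :
    c = t ∧ r = t := by
  have htr := htR r hr.1
  have hts := htS s hs.1
  have hlt := starBound_lt_starBound htR htS hr hs hm hmS h1 h2
  rw [← pairTotal_eq_starBound S hr, ← pairTotal_eq_starBound R hs] at hlt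
  have hle := pairTotal_self_le ht hr hs htr hts (n := n) (by omega)
  rw [max_eq_left hlt.le] at hle
  have hcs' : c < s := lt_of_le_of_ne hcs fun h => by rw [h] at heq; omega
  rcases htc.eq_or_lt with rfl | htc'
  · refine ⟨rfl, ?_⟩
    rw [pairTotal_self_comm] at heq
    exact (eq_of_pairTotal_eq_left ht htR htS hr hs hm hmS h1 (by omega) le_rfl htr heq).symm
  · exfalso
    rw [pairTotal_self_comm] at hle
    have := lt_max_ends (fun a h1 h2 => pairTotal_increase_persists_strictly (a := a) (n := n)
      ht hs hr htr (by omega) h1 h2) htc' hcs'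
    omega

end LargeGroundSet

/-! ### Families of subsets of `Fin n` -/

theorem card_filter_card_inter {n : ℕ} (X : Finset (Fin n)) {i j : ℕ} (hji : j ≤ i) :
    ((univ : Finset (Finset (Fin n))).filter fun Y => Y.card = i ∧ (Y ∩ X).card = j).card =
      X.card.choose j * (n - X.card).choose (i - j) := by
  have hc : Xᶜ.card = n - X.card := by rw [card_compl, Fintype.card_fin]
  rw [← hc, ← card_powersetCard, ← card_powersetCard, ← card_product]
  refine card_nbij' (fun Y => (Y ∩ X, Y \ X)) (fun Z => Z.1 ∪ Z.2) ?_ ?_ ?_ ?_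
  · intro Y hY
    obtain ⟨-, h1, h2⟩ := mem_filter.1 (mem_coe.1 hY)
    have h3 := card_inter_add_card_sdiff Y X
    refine mem_coe.2 (mem_product.2 ⟨mem_powersetCard.2 ⟨inter_subset_right, h2⟩,
      mem_powersetCard.2 ⟨fun x hx => mem_compl.2 (mem_sdiff.1 hx).2, ?_⟩⟩)
    dsimp only
    omega
  · rintro ⟨U, V⟩ hZ
    obtain ⟨h1, h2⟩ := mem_product.1 (mem_coe.1 hZ)
    obtain ⟨hU, hU'⟩ := mem_powersetCard.1 h1
    obtain ⟨hV, hV'⟩ := mem_powersetCard.1 h2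
    dsimp only at *
    have hVX : Disjoint V X := (subset_compl_iff_disjoint_right.1 hV)
    have hd : Disjoint U V := (hVX.mono_right hU).symm
    refine mem_coe.2 (mem_filter.2 ⟨mem_univ _, ?_, ?_⟩)
    · rw [card_union_of_disjoint hd]; omega
    · rw [union_inter_distrib_right, disjoint_iff_inter_eq_empty.1 hVX, union_empty,
        inter_eq_left.2 hU, hU']
  · intro Y _
    dsimp only
    rw [union_comm, sdiff_union_inter]
  · rintro ⟨U, V⟩ hZ
    obtain ⟨h1, h2⟩ := mem_product.1 (mem_coe.1 hZ)
    have hU := (mem_powersetCard.1 h1).1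
    have hVX : Disjoint V X := subset_compl_iff_disjoint_right.1 (mem_powersetCard.1 h2).1
    dsimp only at *
    rw [union_inter_distrib_right, disjoint_iff_inter_eq_empty.1 hVX, union_empty,
      inter_eq_left.2 hU, union_sdiff_distrib, sdiff_eq_empty_iff_subset.2 hU, empty_union,
      hVX.sdiff_eq_left]

theorem mem_layers {n : ℕ} {M : Finset ℕ} {A : Finset (Fin n)} :
    A ∈ layers n M ↔ A.card ∈ M := by
  simp [layers]

theorem one_add_card_filter_eq_starBound {n t : ℕ} (M : Finset ℕ) (X : Finset (Fin n)) :
    1 + ((layers n M).filter fun Y => t ≤ (Y ∩ X).card).card = starBound n t X.card M := by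
  unfold starBound
  congr 1
  rw [card_eq_sum_card_fiberwise (f := card) (t := M)
    (fun Y hY => mem_layers.1 (mem_filter.1 (mem_coe.1 hY)).1)]
  refine sum_congr rfl fun i hi => ?_
  rw [card_eq_sum_card_fiberwise (f := fun Y => (Y ∩ X).card) (t := Icc t i)]
  · refine sum_congr rfl fun j hj => ?_
    rw [← card_filter_card_inter X (mem_Icc.1 hj).2]
    congr 1
    ext Y
    simp only [mem_filter, mem_layers, mem_univ, true_and]
    constructor
    · rintro ⟨⟨-, h1⟩, h2⟩; exact ⟨h1, h2⟩
    · rintro ⟨h1, h2⟩; exact ⟨⟨⟨h1 ▸ hi, h2 ▸ (mem_Icc.1 hj).1⟩, h1⟩, h2⟩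
  · intro Y hY
    obtain ⟨h1, h2⟩ := mem_filter.1 (mem_coe.1 hY)
    refine mem_coe.2 (mem_Icc.2 ⟨(mem_filter.1 h1).2, ?_⟩)
    rw [← h2]
    exact card_le_card inter_subset_left

theorem isSingletonPair_card {n t a : ℕ} {M : Finset ℕ} {𝒳 𝒴 : Finset (Finset (Fin n))}
    (h : IsSingletonPair t a M 𝒳 𝒴) : 𝒳.card + 𝒴.card = starBound n t a M := by
  obtain ⟨X, rfl, rfl, rfl⟩ := h
  rw [card_singleton, one_add_card_filter_eq_starBound]

theorem isSingletonPair_of_card {n t a : ℕ} {M : Finset ℕ} {𝒳 𝒴 : Finset (Finset (Fin n))}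
    (h𝒴 : 𝒴 ⊆ layers n M) (h : CrossIntersecting t 𝒳 𝒴) (h1 : 𝒳.card = 1)
    (ha : ∀ X ∈ 𝒳, X.card = a) (hle : starBound n t a M ≤ 𝒳.card + 𝒴.card) :
    IsSingletonPair t a M 𝒳 𝒴 := by
  obtain ⟨X, rfl⟩ := card_eq_one.1 h1
  have hX := ha X (mem_singleton_self X)
  refine ⟨X, hX, rfl, eq_of_subset_of_card_le (fun Y hY => ?_) ?_⟩
  · refine mem_filter.2 ⟨h𝒴 hY, ?_⟩
    rw [inter_comm]
    exact h X (mem_singleton_self X) Y hY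
  · have := one_add_card_filter_eq_starBound (t := t) M X
    rw [hX] at this
    rw [card_singleton] at hle
    omega

/-- A family of subsets of `Fin n`, regarded as a family of sets of natural numbers. -/
def toNatFamily {n : ℕ} (𝒜 : Finset (Finset (Fin n))) : Finset (Finset ℕ) :=
  𝒜.map (mapEmbedding Fin.valEmbedding).toEmbedding

theorem mem_toNatFamily {n : ℕ} {𝒜 : Finset (Finset (Fin n))} {U : Finset ℕ} :
    U ∈ toNatFamily 𝒜 ↔ ∃ A ∈ 𝒜, A.map Fin.valEmbedding = U := by
  simp [toNatFamily]

theorem weight_toNatFamily {n : ℕ} (w : ℕ → ℕ) (𝒜 : Finset (Finset (Fin n))) :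
    weight w (toNatFamily 𝒜) = ∑ A ∈ 𝒜, w A.card := by
  simp [weight, toNatFamily]

theorem subset_range_of_mem_toNatFamily {n : ℕ} {𝒜 : Finset (Finset (Fin n))} :
    ∀ U ∈ toNatFamily 𝒜, U ⊆ range n := by
  intro U hU x hx
  obtain ⟨A, -, rfl⟩ := mem_toNatFamily.1 hU
  obtain ⟨y, -, rfl⟩ := mem_map.1 hx
  exact mem_range.2 y.2

theorem cross_toNatFamily {n t : ℕ} {𝒜 ℬ : Finset (Finset (Fin n))}
    (h : CrossIntersecting t 𝒜 ℬ) : Cross t (toNatFamily 𝒜) (toNatFamily ℬ) := by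
  intro U hU V hV
  obtain ⟨A, hA, rfl⟩ := mem_toNatFamily.1 hU
  obtain ⟨B, hB, rfl⟩ := mem_toNatFamily.1 hV
  rw [← map_inter, card_map]
  exact h A hA B hB

theorem extCount_card_pos {n : ℕ} {M : Finset ℕ} {𝒜 : Finset (Finset (Fin n))}
    (h : 𝒜 ⊆ layers n M) : ∀ U ∈ toNatFamily 𝒜, 0 < extCount 0 M U.card := by
  intro U hU
  obtain ⟨A, hA, rfl⟩ := mem_toNatFamily.1 hU
  rw [card_map, extCount_zero, if_pos (mem_layers.1 (h hA))]
  exact one_pos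

theorem weight_extCount_zero {n : ℕ} {M : Finset ℕ} {𝒜 : Finset (Finset (Fin n))}
    (h : 𝒜 ⊆ layers n M) : weight (extCount 0 M) (toNatFamily 𝒜) = 𝒜.card := by
  rw [weight_toNatFamily, card_eq_sum_ones]
  exact sum_congr rfl fun A hA => by rw [extCount_zero, if_pos (mem_layers.1 (h hA))]

theorem toNatFamily_nonempty {n : ℕ} {𝒜 : Finset (Finset (Fin n))} (h : 𝒜.Nonempty) :
    (toNatFamily 𝒜).Nonempty := by
  obtain ⟨A, hA⟩ := h
  exact ⟨_, mem_toNatFamily.2 ⟨A, hA, rfl⟩⟩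

section Families

variable {n t r s : ℕ} {R S : Finset ℕ} {𝒜 ℬ : Finset (Finset (Fin n))}

theorem card_add_card_le (ht : 0 < t) (hr : IsGreatest (R : Set ℕ) r)
    (hs : IsGreatest (S : Set ℕ) s) (htr : t ≤ r) (hts : t ≤ s) (hn : r + s + 1 ≤ n + t)
    (h𝒜 : 𝒜 ⊆ layers n R) (hℬ : ℬ ⊆ layers n S) (hA : 𝒜.Nonempty) (hB : ℬ.Nonempty)
    (h : CrossIntersecting t 𝒜 ℬ) :
    𝒜.card + ℬ.card ≤ max (starBound n t r S) (starBound n t s R) := by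
  have := weight_add_weight_le ht hr hs htr hts hn (a := n) (N := 0) (by omega)
    subset_range_of_mem_toNatFamily subset_range_of_mem_toNatFamily (cross_toNatFamily h)
    (extCount_card_pos h𝒜) (extCount_card_pos hℬ) (toNatFamily_nonempty hA)
    (toNatFamily_nonempty hB)
  rwa [weight_extCount_zero h𝒜, weight_extCount_zero hℬ, pairTotal_eq_starBound S hr,
    pairTotal_eq_starBound R hs] at this

/-- Families attaining the bound have the same number of sets of each size as a canonical pair. -/
theorem exists_canonical_of_card_eq (ht : 0 < t) (hr : IsGreatest (R : Set ℕ) r)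
    (hs : IsGreatest (S : Set ℕ) s) (htr : t ≤ r) (hts : t ≤ s) (hn : r + s + 2 ≤ n + t)
    (h𝒜 : 𝒜 ⊆ layers n R) (hℬ : ℬ ⊆ layers n S) (hA : 𝒜.Nonempty) (hB : ℬ.Nonempty)
    (h : CrossIntersecting t 𝒜 ℬ)
    (heq : 𝒜.card + ℬ.card = max (starBound n t r S) (starBound n t s R)) :
    ∃ (𝒜' ℬ' : Finset (Finset ℕ)) (c : ℕ),
      (∀ w, weight w 𝒜' = weight w (toNatFamily 𝒜)) ∧
      (∀ w, weight w ℬ' = weight w (toNatFamily ℬ)) ∧ t ≤ c ∧ c ≤ n ∧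
      ((c ≤ r ∧ pairTotal n t R S c = max (pairTotal n t R S r) (pairTotal n t S R s) ∧
        IsCanonicalPair 0 n t c R S 𝒜' ℬ') ∨
      (c ≤ s ∧ pairTotal n t S R c = max (pairTotal n t R S r) (pairTotal n t S R s) ∧
        IsCanonicalPair 0 n t c S R ℬ' 𝒜')) := by
  obtain ⟨𝒜', ℬ', hA', hB', h', hshA, hshB, hwA, hwB⟩ := exists_shifted (toNatFamily 𝒜)
    (toNatFamily ℬ) subset_range_of_mem_toNatFamily subset_range_of_mem_toNatFamily
    (cross_toNatFamily h)
  obtain ⟨c, htc, hcn, hc⟩ := exists_isCanonicalPair ht hr hs htr hts hn (a := n) (N := 0)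
    (by omega) hA' hB' h' hshA hshB
    (forall_card_of_weight_eq hwA (p := fun k => 0 < extCount 0 R k) (extCount_card_pos h𝒜))
    (forall_card_of_weight_eq hwB (p := fun k => 0 < extCount 0 S k) (extCount_card_pos hℬ))
    (card_pos.1 (card_eq_of_weight_eq hwA ▸ card_pos.2 (toNatFamily_nonempty hA)))
    (card_pos.1 (card_eq_of_weight_eq hwB ▸ card_pos.2 (toNatFamily_nonempty hB)))
    (by rw [hwA, hwB, weight_extCount_zero h𝒜, weight_extCount_zero hℬ, heq,
      pairTotal_eq_starBound S hr, pairTotal_eq_starBound R hs])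
  exact ⟨𝒜', ℬ', c, hwA, hwB, htc, hcn, hc⟩

theorem IsCanonicalPair.left_eq_singleton {𝒜' ℬ' : Finset (Finset ℕ)}
    (hr : IsGreatest (R : Set ℕ) r) (hrn : r ≤ n) (h : IsCanonicalPair 0 n t r R S 𝒜' ℬ') :
    𝒜' = {range r} := by
  rw [h.1]
  ext U
  rw [mem_filter, mem_singleton, mem_powerset, extCount_zero]
  constructor
  · rintro ⟨-, h1, h2⟩
    by_cases hU : U.card ∈ R
    · have : U.card ≤ r := hr.2 hU
      exact (eq_of_subset_of_card_le h1 (by rwa [card_range])).symm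
    · simp [hU] at h2
  · rintro rfl
    refine ⟨range_subset_range.2 hrn, Subset.rfl, ?_⟩
    rw [card_range, if_pos (mem_coe.1 hr.1)]
    exact one_pos

theorem isSingletonPair_of_weight_eq (h𝒜 : ∀ w, weight w {range r} = weight w (toNatFamily 𝒜))
    (hℬ : ℬ ⊆ layers n S) (h : CrossIntersecting t 𝒜 ℬ)
    (hle : starBound n t r S ≤ 𝒜.card + ℬ.card) : IsSingletonPair t r S 𝒜 ℬ := by
  have h1 : 𝒜.card = 1 := by
    have := h𝒜 fun _ => 1
    rw [weight_toNatFamily] at this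
    simpa [weight] using this.symm
  refine isSingletonPair_of_card hℬ h h1 (fun X hX => ?_) hle
  have h2 := forall_card_of_weight_eq (fun w => (h𝒜 w).symm) (p := fun k => k = r)
    (by simp) _ (mem_toNatFamily.2 ⟨X, hX, rfl⟩)
  rwa [card_map] at h2

/-- The equality case for different sets of sizes, when the largest differing size is in `S`. -/
theorem card_add_card_eq_iff_of_mem {m : ℕ} (ht : 0 < t) (htR : ∀ i ∈ R, t ≤ i)
    (htS : ∀ i ∈ S, t ≤ i) (hr : IsGreatest (R : Set ℕ) r) (hs : IsGreatest (S : Set ℕ) s)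
    (hm : IsGreatest ((symmDiff R S : Finset ℕ) : Set ℕ) m) (hmS : m ∈ S)
    (h1 : 2 ^ (s + 1) * R.card * (s - t) + 2 * r + 1 ≤ n)
    (h2 : 2 ^ (r + 1) * S.card * (r - t) + 2 * s + 1 ≤ n)
    (h𝒜 : 𝒜 ⊆ layers n R) (hℬ : ℬ ⊆ layers n S) (hA : 𝒜.Nonempty) (hB : ℬ.Nonempty)
    (h : CrossIntersecting t 𝒜 ℬ) :
    𝒜.card + ℬ.card = max (starBound n t r S) (starBound n t s R) ↔
      IsSingletonPair t r S 𝒜 ℬ := by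
  have htr := htR r hr.1
  have hts := htS s hs.1
  have hlt := starBound_lt_starBound htR htS hr hs hm hmS h1 h2
  constructor
  · intro heq
    obtain ⟨𝒜', ℬ', c, hwA, hwB, htc, hcn, hc⟩ := exists_canonical_of_card_eq ht hr hs htr hts
      (by omega) h𝒜 hℬ hA hB h heq
    rw [max_eq_left hlt.le] at heq
    rw [pairTotal_eq_starBound S hr, pairTotal_eq_starBound R hs, max_eq_left hlt.le,
      ← pairTotal_eq_starBound S hr] at hc
    suffices hs1 : 𝒜' = {range r} by
      subst hs1
      exact isSingletonPair_of_weight_eq hwA hℬ h heq.ge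
    rcases hc with ⟨hcr, hc, hcan⟩ | ⟨hcs, hc, hcan⟩
    · obtain rfl := eq_of_pairTotal_eq_left ht htR htS hr hs hm hmS h1 (by omega) htc hcr hc
      exact hcan.left_eq_singleton hr (by omega)
    · -- here `R = {t}`, and the two kinds of canonical pairs agree
      obtain ⟨rfl, hrt⟩ := eq_of_pairTotal_eq_right ht htR htS hr hs hm hmS h1 h2 htc hcs hc
      subst hrt
      rw [hcan.2]
      ext U
      rw [mem_filter, mem_singleton, mem_powerset, extCount_zero]
      constructor
      · rintro ⟨-, h3, h4⟩
        by_cases hU : U.card ∈ R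
        · have h5 : U.card ≤ r := hr.2 hU
          have h6 : U ∩ range r = U := eq_of_subset_of_card_le inter_subset_left (by omega)
          exact eq_of_subset_of_card_le (inter_eq_left.1 h6)
            (by rw [card_range]; exact htR _ hU)
        · simp [hU] at h4
      · rintro rfl
        refine ⟨range_subset_range.2 hcn, by rw [inter_self, card_range], ?_⟩
        rw [card_range, if_pos (mem_coe.1 hr.1)]
        exact one_pos
  · intro hp
    rw [max_eq_left hlt.le]
    exact isSingletonPair_card hp

end Families

/-! ### Stars and equal sets of sizes -/

/-- If all members of `F` are pairs through `z` meeting both of the pairs `B`, `B'`, which avoid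
`z`, then `F` has at most one member unless `B = B'`. -/
theorem eq_of_pairs_meet {β : Type*} [DecidableEq β] {F : Finset (Finset β)} {z : β}
    {B B' : Finset β} (hF : ∀ A ∈ F, A.card = 2 ∧ z ∈ A ∧ (A ∩ B).Nonempty ∧ (A ∩ B').Nonempty)
    (h2 : 2 ≤ F.card) (hB : B.card = 2) (hB' : B'.card = 2) (hzB : z ∉ B) (hzB' : z ∉ B') :
    B = B' := by
  have hsub : F ⊆ (B ∩ B').image fun b => {z, b} := by
    intro A hA
    obtain ⟨hA2, hzA, ⟨b, hb⟩, ⟨b', hb'⟩⟩ := hF A hA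
    rw [mem_inter] at hb hb'
    have hbz : b ≠ z := fun e => hzB (e ▸ hb.2)
    have hbz' : b' ≠ z := fun e => hzB' (e ▸ hb'.2)
    have e : {z, b} = A := eq_of_subset_of_card_le
      (insert_subset hzA (singleton_subset_iff.2 hb.1)) (by rw [hA2, card_pair hbz.symm])
    have hbb : b' = b := by
      have := hb'.1
      rw [← e, mem_insert, mem_singleton] at this
      tauto
    exact mem_image.2 ⟨b, mem_inter.2 ⟨hb.2, hbb ▸ hb'.2⟩, e⟩
  have h3 : 2 ≤ (B ∩ B').card := h2.trans ((card_le_card hsub).trans card_image_le)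
  have h4 : B ∩ B' = B := eq_of_subset_of_card_le inter_subset_left (by omega)
  have h5 : B ∩ B' = B' := eq_of_subset_of_card_le inter_subset_right (by omega)
  rw [← h4, h5]

theorem mem_of_three_pairs_meet {β : Type*} [DecidableEq β] {F : Finset (Finset β)} {z : β}
    {B : Finset β} (hF : ∀ A ∈ F, A.card = 2 ∧ z ∈ A ∧ (A ∩ B).Nonempty)
    (h3 : 3 ≤ F.card) (hB : B.card = 2) : z ∈ B := by
  by_contra hzB
  have hsub : F ⊆ B.image fun b => {z, b} := by
    intro A hA
    obtain ⟨hA2, hzA, ⟨b, hb⟩⟩ := hF A hA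
    rw [mem_inter] at hb
    have hbz : b ≠ z := fun e => hzB (e ▸ hb.2)
    exact mem_image.2 ⟨b, hb.2, eq_of_subset_of_card_le
      (insert_subset hzA (singleton_subset_iff.2 hb.1)) (by rw [hA2, card_pair hbz.symm])⟩
  have := (card_le_card hsub).trans card_image_le
  omega

/-- Two cross-intersecting graphs with at least four edges each are contained in a common star. -/
theorem exists_common_mem_of_pairs {β : Type*} [DecidableEq β] {𝒜 ℬ : Finset (Finset β)}
    (hA : ∀ A ∈ 𝒜, A.card = 2) (hB : ∀ B ∈ ℬ, B.card = 2)
    (h : ∀ A ∈ 𝒜, ∀ B ∈ ℬ, (A ∩ B).Nonempty) (hA4 : 4 ≤ 𝒜.card) (hB4 : 4 ≤ ℬ.card) :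
    ∃ z, (∀ A ∈ 𝒜, z ∈ A) ∧ ∀ B ∈ ℬ, z ∈ B := by
  have hz : ∃ z, 2 ≤ (𝒜.filter fun A => z ∈ A).card := by
    obtain ⟨B, hBm⟩ := card_pos.1 (show 0 < ℬ.card by omega)
    obtain ⟨x, y, -, rfl⟩ := card_eq_two.1 (hB B hBm)
    have hsub : 𝒜 ⊆ (𝒜.filter fun A => x ∈ A) ∪ 𝒜.filter fun A => y ∈ A := by
      intro A hAm
      obtain ⟨b, hb⟩ := h A hAm _ hBm
      rw [mem_inter, mem_insert, mem_singleton] at hb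
      rw [mem_union, mem_filter, mem_filter]
      rcases hb with ⟨hb, rfl | rfl⟩
      · exact Or.inl ⟨hAm, hb⟩
      · exact Or.inr ⟨hAm, hb⟩
    have := (card_le_card hsub).trans (card_union_le _ _)
    by_contra! hn
    have h1 := hn x
    have h2 := hn y
    omega
  obtain ⟨z, hz⟩ := hz
  have hnot : (ℬ.filter fun B => z ∉ B).card ≤ 1 := by
    refine card_le_one.2 fun B hBm B' hBm' => ?_
    obtain ⟨h1, h2⟩ := mem_filter.1 hBm
    obtain ⟨h3, h4⟩ := mem_filter.1 hBm'
    exact eq_of_pairs_meet (fun A hAm => ⟨hA A (mem_filter.1 hAm).1, (mem_filter.1 hAm).2,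
      h A (mem_filter.1 hAm).1 B h1, h A (mem_filter.1 hAm).1 B' h3⟩) hz (hB B h1) (hB B' h3) h2 h4
  have hB3 : 3 ≤ (ℬ.filter fun B => z ∈ B).card := by
    have := card_filter_add_card_filter_not (s := ℬ) (fun B => z ∈ B)
    omega
  have hAz : ∀ A ∈ 𝒜, z ∈ A := fun A hAm =>
    mem_of_three_pairs_meet (fun B hBm => ⟨hB B (mem_filter.1 hBm).1, (mem_filter.1 hBm).2,
      by rw [inter_comm]; exact h A hAm B (mem_filter.1 hBm).1⟩) hB3 (hA A hAm)
  exact ⟨z, hAz, fun B hBm => mem_of_three_pairs_meet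
    (fun A hAm => ⟨hA A hAm, hAz A hAm, h A hAm B hBm⟩) (by omega) (hB B hBm)⟩

theorem card_star {n : ℕ} {M : Finset ℕ} (hM : ∀ i ∈ M, 1 ≤ i) (x : Fin n) :
    ((layers n M).filter fun C => x ∈ C).card = extCount (n - 1) M 1 := by
  have h1 := one_add_card_filter_eq_starBound (t := 1) M {x}
  have e : ((layers n M).filter fun Y => 1 ≤ (Y ∩ {x}).card) =
      (layers n M).filter fun C => x ∈ C := by
    refine filter_congr fun Y _ => ?_
    rw [Nat.succ_le_iff, card_pos]
    constructor
    · rintro ⟨y, hy⟩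
      rw [mem_inter, mem_singleton] at hy
      exact hy.2 ▸ hy.1
    · exact fun hx => ⟨x, mem_inter.2 ⟨hx, mem_singleton_self x⟩⟩
  rw [e, starBound, Nat.add_left_cancel_iff, card_singleton] at h1
  rw [h1, extCount]
  refine sum_congr rfl fun i hi => ?_
  rw [if_pos (hM i hi), sum_eq_single 1]
  · simp
  · intro j hj hne
    rw [Nat.choose_eq_zero_of_lt (by have := (mem_Icc.1 hj).1; omega), zero_mul]
  · exact fun hn => absurd (mem_Icc.2 ⟨le_rfl, hM i hi⟩) hn

theorem pairTotal_one (n : ℕ) (R : Finset ℕ) :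
    pairTotal n 1 R R 1 = 2 * extCount (n - 1) R 1 := by
  unfold pairTotal
  rw [show (Ico 1 (1 + 1)) = {1} from rfl, sum_singleton, Nat.choose_self]
  ring

theorem pairTotal_two {n : ℕ} (hn : 1 < n) (R : Finset ℕ) :
    pairTotal n 1 R R 2 = 2 * extCount (n - 1) R 1 := by
  have := pairTotal_succ (n := n) (t := 1) (a := 1) R R one_pos (by omega) hn
  rw [Nat.sub_self, Nat.choose_zero_right, one_mul] at this
  rw [← pairTotal_one]
  exact Nat.add_right_cancel this

section SameSizes

variable {n t r : ℕ} {R : Finset ℕ} {𝒜 ℬ : Finset (Finset (Fin n))}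

theorem subset_one_two (hr : IsGreatest (R : Set ℕ) 2) (h1 : ∀ i ∈ R, 1 ≤ i) :
    R = {1, 2} ∨ R = {2} := by
  have h2 : ∀ i ∈ R, i ≤ 2 := fun i hi => hr.2 hi
  have h3 : 2 ∈ R := hr.1
  by_cases h : 1 ∈ R
  · left
    ext i
    rw [mem_insert, mem_singleton]
    refine ⟨fun hi => ?_, ?_⟩
    · have := h1 i hi; have := h2 i hi; omega
    · rintro (rfl | rfl) <;> assumption
  · right
    ext i
    rw [mem_singleton]
    refine ⟨fun hi => ?_, ?_⟩
    · have := h1 i hi; have := h2 i hi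
      have : i ≠ 1 := fun e => h (e ▸ hi)
      omega
    · rintro rfl; exact h3

theorem isStarPair_of_forall_mem (h1 : ∀ i ∈ R, 1 ≤ i) (h𝒜 : 𝒜 ⊆ layers n R)
    (hℬ : ℬ ⊆ layers n R) {x : Fin n} (hA : ∀ A ∈ 𝒜, x ∈ A) (hB : ∀ B ∈ ℬ, x ∈ B)
    (hcard : 𝒜.card + ℬ.card = 2 * extCount (n - 1) R 1) : IsStarPair R 𝒜 ℬ := by
  have hc := card_star h1 x
  have sA : 𝒜 ⊆ (layers n R).filter fun C => x ∈ C := fun A hAm =>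
    mem_filter.2 ⟨h𝒜 hAm, hA A hAm⟩
  have sB : ℬ ⊆ (layers n R).filter fun C => x ∈ C := fun B hBm =>
    mem_filter.2 ⟨hℬ hBm, hB B hBm⟩
  have cA := card_le_card sA
  have cB := card_le_card sB
  exact ⟨x, eq_of_subset_of_card_le sA (by omega), eq_of_subset_of_card_le sB (by omega)⟩

theorem IsCanonicalPair.eq_of_one {S : Finset ℕ} {𝒜' ℬ' : Finset (Finset ℕ)}
    (h : IsCanonicalPair 0 n 1 1 S S 𝒜' ℬ') : 𝒜' = ℬ' ∧
      𝒜' = (range n).powerset.filter fun U => range 1 ⊆ U ∧ 0 < extCount 0 S U.card := by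
  refine ⟨?_, h.1⟩
  rw [h.1, h.2]
  refine filter_congr fun U _ => ?_
  have : range 1 ⊆ U ↔ 1 ≤ (U ∩ range 1).card := by
    rw [Nat.succ_le_iff, card_pos]
    constructor
    · exact fun hh => ⟨0, mem_inter.2 ⟨hh (by simp), by simp⟩⟩
    · rintro ⟨y, hy⟩ z hz
      rw [mem_inter, mem_range] at hy
      rw [mem_range] at hz
      have : z = y := by omega
      exact this ▸ hy.1
  rw [this]

/-- Families with the sizes of the star of `0`, among the sets of size `2` or of size `1` or `2`,
form a star. -/
theorem isStarPair_of_weight_eq (hn : 4 < n) (hr : IsGreatest (R : Set ℕ) 2)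
    (h1 : ∀ i ∈ R, 1 ≤ i) (h𝒜 : 𝒜 ⊆ layers n R) (hℬ : ℬ ⊆ layers n R)
    (h : CrossIntersecting 1 𝒜 ℬ) {𝒞 : Finset (Finset ℕ)}
    (h𝒞 : 𝒞 = (range n).powerset.filter fun U => range 1 ⊆ U ∧ 0 < extCount 0 R U.card)
    (hwA : ∀ w, weight w 𝒞 = weight w (toNatFamily 𝒜))
    (hwB : ∀ w, weight w 𝒞 = weight w (toNatFamily ℬ))
    (hcard : 𝒜.card + ℬ.card = 2 * extCount (n - 1) R 1) :
    ((R = {1, 2} ∧ R = {1, 2}) ∧ IsStarPair {1, 2} 𝒜 ℬ) ∨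
      ((R = {2} ∧ R = {2}) ∧ IsStarPair {2} 𝒜 ℬ) := by
  rcases subset_one_two hr h1 with hR | hR
  · left
    have single : ∀ {𝒟 : Finset (Finset (Fin n))},
        (∀ w, weight w 𝒞 = weight w (toNatFamily 𝒟)) → ∃ x : Fin n, {x} ∈ 𝒟 := by
      intro 𝒟 hw
      by_contra! hno
      have h2 := forall_card_of_weight_eq hw (p := fun k => k ≠ 1) (fun U hU hU1 => by
        obtain ⟨A, hA, rfl⟩ := mem_toNatFamily.1 hU
        rw [card_map] at hU1
        obtain ⟨x, rfl⟩ := card_eq_one.1 hU1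
        exact hno x hA)
      refine h2 (range 1) ?_ (card_range 1)
      rw [h𝒞]
      refine mem_filter.2 ⟨mem_powerset.2 (range_subset_range.2 (by omega)), Subset.rfl, ?_⟩
      rw [card_range, extCount_zero, if_pos (by rw [hR]; simp)]
      exact one_pos
    have meet : ∀ {x : Fin n} {C : Finset (Fin n)}, 1 ≤ (C ∩ {x}).card → x ∈ C := by
      intro x C hC
      obtain ⟨y, hy⟩ := card_pos.1 hC
      rw [mem_inter, mem_singleton] at hy
      exact hy.2 ▸ hy.1
    obtain ⟨x, hx⟩ := single hwA
    obtain ⟨y, hy⟩ := single hwB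
    have hxy : y = x := mem_singleton.1 (meet (h _ hx _ hy))
    subst hxy
    refine ⟨⟨hR, hR⟩, ?_⟩
    rw [← hR]
    exact isStarPair_of_forall_mem h1 h𝒜 hℬ (fun A hA => meet (h A hA _ hy))
      (fun B hB => meet (by rw [inter_comm]; exact h _ hx B hB)) hcard
  · right
    refine ⟨⟨hR, hR⟩, ?_⟩
    have hAB : 𝒜.card = ℬ.card := by
      rw [← weight_extCount_zero h𝒜, ← weight_extCount_zero hℬ, ← hwA, ← hwB]
    have he : extCount (n - 1) R 1 = n - 1 := by
      rw [hR, extCount, sum_singleton]; simp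
    obtain ⟨x, hxA, hxB⟩ := exists_common_mem_of_pairs (𝒜 := 𝒜) (ℬ := ℬ)
      (fun A hA => by have := mem_layers.1 (h𝒜 hA); simpa [hR] using this)
      (fun A hA => by have := mem_layers.1 (hℬ hA); simpa [hR] using this)
      (fun A hA B hB => card_pos.1 (h A hA B hB)) (by omega) (by omega)
    rw [← hR]
    exact isStarPair_of_forall_mem h1 h𝒜 hℬ hxA hxB hcard

theorem card_eq_of_isStarPair (ht : 0 < t) (htR : ∀ i ∈ R, t ≤ i)
    (hr : IsGreatest (R : Set ℕ) 2) (hn : 4 < n) (hp : IsStarPair R 𝒜 ℬ)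
    (hle : 𝒜.card + ℬ.card ≤ starBound n t 2 R) : 𝒜.card + ℬ.card = starBound n t 2 R := by
  obtain ⟨x, rfl, rfl⟩ := hp
  have h1 : ∀ i ∈ R, 1 ≤ i := fun i hi => ht.trans_le (htR i hi)
  rw [card_star h1] at hle ⊢
  rcases (show t = 1 ∨ t = 2 by have := htR 2 hr.1; omega) with rfl | rfl
  · rw [← pairTotal_eq_starBound R hr, pairTotal_two (by omega)]
    ring
  · -- for `t = 2` the star is larger than the bound, and hence not cross-intersecting
    have hR : R = {2} := by
      ext i
      rw [mem_singleton]
      refine ⟨fun hi => le_antisymm (hr.2 hi) (htR i hi), ?_⟩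
      rintro rfl
      exact hr.1
    subst hR
    simp [extCount, starBound] at hle
    omega

/-- The equality case for equal sets of sizes. -/
theorem card_add_card_eq_iff_of_same (ht : 0 < t) (htR : ∀ i ∈ R, t ≤ i)
    (hr : IsGreatest (R : Set ℕ) r) (hn : 2 * r < n)
    (h𝒜 : 𝒜 ⊆ layers n R) (hℬ : ℬ ⊆ layers n R) (hA : 𝒜.Nonempty) (hB : ℬ.Nonempty)
    (h : CrossIntersecting t 𝒜 ℬ) :
    𝒜.card + ℬ.card = max (starBound n t r R) (starBound n t r R) ↔
      IsSingletonPair t r R 𝒜 ℬ ∨ IsSingletonPair t r R ℬ 𝒜 ∨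
        ((R = {1, 2} ∧ R = {1, 2}) ∧ IsStarPair {1, 2} 𝒜 ℬ) ∨
        ((R = {2} ∧ R = {2}) ∧ IsStarPair {2} 𝒜 ℬ) := by
  have htr := htR r hr.1
  have h' : CrossIntersecting t ℬ 𝒜 := fun B hB A hA => by
    rw [inter_comm]; exact h A hA B hB
  have hle := card_add_card_le ht hr hr htr htr (by omega) h𝒜 hℬ hA hB h
  constructor
  · intro heq
    obtain ⟨𝒜', ℬ', c, hwA, hwB, htc, hcn, hc⟩ := exists_canonical_of_card_eq ht hr hr htr htr
      (by omega) h𝒜 hℬ hA hB h heq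
    rw [max_self] at heq hc
    have hstar : ∀ {𝒞 : Finset (Finset ℕ)}, t = 1 → r = 2 →
        (𝒞 = (range n).powerset.filter fun U => range 1 ⊆ U ∧ 0 < extCount 0 R U.card) →
        (∀ w, weight w 𝒞 = weight w (toNatFamily 𝒜)) →
        (∀ w, weight w 𝒞 = weight w (toNatFamily ℬ)) →
        ((R = {1, 2} ∧ R = {1, 2}) ∧ IsStarPair {1, 2} 𝒜 ℬ) ∨
          ((R = {2} ∧ R = {2}) ∧ IsStarPair {2} 𝒜 ℬ) := by
      rintro 𝒞 rfl rfl h𝒞 h1 h2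
      refine isStarPair_of_weight_eq (by omega) hr htR h𝒜 hℬ h h𝒞 h1 h2 ?_
      rw [heq, ← pairTotal_eq_starBound R hr, pairTotal_two (by omega)]
    rcases hc with ⟨hcr, hc, hcan⟩ | ⟨hcr, hc, hcan⟩
    · rcases eq_of_pairTotal_eq_of_same ht hr (by omega) htc hcr hc with rfl | ⟨h1, h2, h3⟩
      · left
        have := hcan.left_eq_singleton hr hcn
        subst this
        exact isSingletonPair_of_weight_eq hwA hℬ h heq.ge
      · right; right
        rw [h1, h2] at hcan
        obtain ⟨e1, e2⟩ := hcan.eq_of_one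
        subst e1
        exact hstar h1 h3 e2 hwA hwB
    · rcases eq_of_pairTotal_eq_of_same ht hr (by omega) htc hcr hc with rfl | ⟨h1, h2, h3⟩
      · right; left
        have := hcan.left_eq_singleton hr hcn
        subst this
        exact isSingletonPair_of_weight_eq hwB h𝒜 h' (by rw [add_comm]; exact heq.ge)
      · right; right
        rw [h1, h2] at hcan
        obtain ⟨e1, e2⟩ := hcan.eq_of_one
        subst e1
        exact hstar h1 h3 e2 hwA hwB
  · rw [max_self] at hle ⊢
    have hstar : (R = {1, 2} ∨ R = {2}) → IsStarPair R 𝒜 ℬ →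
        𝒜.card + ℬ.card = starBound n t r R := by
      intro hR hp
      have hr2 : r = 2 := by
        have h1 : r ∈ R := hr.1
        have h2 : 2 ≤ r := hr.2 (by rcases hR with rfl | rfl <;> simp)
        rcases hR with rfl | rfl <;> simp at h1 <;> omega
      subst hr2
      exact card_eq_of_isStarPair ht htR hr (by omega) hp hle
    rintro (hp | hp | ⟨⟨hR, -⟩, hp⟩ | ⟨⟨hR, -⟩, hp⟩)
    · exact isSingletonPair_card hp
    · rw [add_comm]; exact isSingletonPair_card hp
    · rw [← hR] at hp; exact hstar (Or.inl hR) hp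
    · rw [← hR] at hp; exact hstar (Or.inr hR) hp

end SameSizes

end CrossIntersect

theorem theorem1 (n r s t : ℕ) (ht : 0 < t) (R S : Finset ℕ)
    (hR : R ⊆ Finset.Icc 1 n) (hS : S ⊆ Finset.Icc 1 n)
    (htRS : ∀ i ∈ R ∪ S, t ≤ i)
    (hr : IsGreatest (R : Set ℕ) r) (hs : IsGreatest (S : Set ℕ) s)
    (hn : r + s - t < n)
    (𝒜 ℬ : Finset (Finset (Fin n)))
    (h𝒜 : 𝒜 ⊆ layers n R) (hℬ : ℬ ⊆ layers n S)
    (h𝒜ne : 𝒜.Nonempty) (hℬne : ℬ.Nonempty)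
    (hcross : CrossIntersecting t 𝒜 ℬ) :
    𝒜.card + ℬ.card ≤ max (starBound n t r S) (starBound n t s R) ∧
    (R = S → 2 * r < n →
      (𝒜.card + ℬ.card = max (starBound n t r S) (starBound n t s R) ↔
        IsSingletonPair t r S 𝒜 ℬ ∨
        IsSingletonPair t s R ℬ 𝒜 ∨
        ((R = {1, 2} ∧ S = {1, 2}) ∧ IsStarPair {1, 2} 𝒜 ℬ) ∨
        ((R = {2} ∧ S = {2}) ∧ IsStarPair {2} 𝒜 ℬ))) ∧
    (R ≠ S →
      max (2 ^ (s + 1) * R.card * (s - t) + 2 * r + 1)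
        (2 ^ (r + 1) * S.card * (r - t) + 2 * s + 1) ≤ n →
      (𝒜.card + ℬ.card = max (starBound n t r S) (starBound n t s R) ↔
        ((∃ m ∈ S, IsGreatest ((symmDiff R S : Finset ℕ) : Set ℕ) m) ∧ IsSingletonPair t r S 𝒜 ℬ) ∨
        ((∃ m ∈ R, IsGreatest ((symmDiff R S : Finset ℕ) : Set ℕ) m) ∧ IsSingletonPair t s R ℬ 𝒜))) := by
  have htR : ∀ i ∈ R, t ≤ i := fun i hi => htRS i (Finset.mem_union_left _ hi)
  have htS : ∀ i ∈ S, t ≤ i := fun i hi => htRS i (Finset.mem_union_right _ hi)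
  have htr := htR r hr.1
  have hts := htS s hs.1
  refine ⟨CrossIntersect.card_add_card_le ht hr hs htr hts (by omega) h𝒜 hℬ h𝒜ne hℬne hcross,
    ?_, ?_⟩
  · rintro rfl h2r
    obtain rfl := hr.unique hs
    exact CrossIntersect.card_add_card_eq_iff_of_same ht htR hr h2r h𝒜 hℬ h𝒜ne hℬne hcross
  · intro hne hmax
    obtain ⟨h1, h2⟩ := max_le_iff.1 hmax
    have hD : (symmDiff R S).Nonempty :=
      Finset.nonempty_iff_ne_empty.2 fun h => hne (symmDiff_eq_bot.1 h)
    have hm := Finset.isGreatest_max' (symmDiff R S) hD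
    generalize (symmDiff R S).max' hD = m at hm
    rcases Finset.mem_symmDiff.1 (Finset.mem_coe.1 hm.1) with ⟨hmR, hmS⟩ | ⟨hmS, hmR⟩
    · have hm' : IsGreatest ((symmDiff S R : Finset ℕ) : Set ℕ) m := by rwa [symmDiff_comm]
      rw [add_comm, max_comm, CrossIntersect.card_add_card_eq_iff_of_mem ht htS htR hs hr hm' hmR
        h2 h1 hℬ h𝒜 hℬne h𝒜ne fun B hB A hA => by rw [Finset.inter_comm]; exact hcross A hA B hB]
      constructor
      · exact fun hp => Or.inr ⟨⟨m, hmR, hm⟩, hp⟩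
      · rintro (⟨⟨m', hmS', hm'⟩, -⟩ | ⟨-, hp⟩)
        · exact absurd (hm.unique hm' ▸ hmS') hmS
        · exact hp
    · rw [CrossIntersect.card_add_card_eq_iff_of_mem ht htR htS hr hs hm hmS h1 h2 h𝒜 hℬ h𝒜ne
        hℬne hcross]
      constructor
      · exact fun hp => Or.inl ⟨⟨m, hmS, hm⟩, hp⟩
      · rintro (⟨-, hp⟩ | ⟨⟨m', hmR', hm'⟩, -⟩)
        · exact hp
        · exact absurd (hm.unique hm' ▸ hmR') hmR
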